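/- Identify the space $\mathrm{Hom}(\mathbb{C}^4\otimes\mathbb{C}^4,\mathbb{C}^4)$ of bilinear multiplications on $\mathbb{C}^4$ (standard basis $e_1,\dots,e_4$) with $\mathbb{C}^{64}$ by means of the structure constants $c_{ij}^k$, $e_ie_j=\sum_k c_{ij}^k e_k$, and give it the Zariski topology. Let $\mathfrak{Leib}_4$ be the closed subset of multiplications satisfying the Leibniz identity $(xy)z=(xz)y+x(yz)$, and let $\mathfrak{Lie}_4\subset\mathfrak{Leib}_4$ be the closed subset of Lie algebra multiplications. The group $GL_4(\mathbb{C})$ acts by $(g*\mu)(x,y)=g\,\mu(g^{-1}x,g^{-1}y)$; $O(\mu)$ denotes the orbit of $\mu$, and $\overline{X}$ denotes the Zariski closure of $X$. An irreducible component of a variety is a maximal irreducible closed subset of it. Consider the following multiplications, where products of basis vectors that are not listed are zero and $a,b\in\mathbb{C}$: - $\mathfrak{sl}_2$: $e_1e_2=-e_2e_1=e_2$, $e_1e_3=-e_3e_1=-e_3$, $e_2e_3=-e_3e_2=e_1$ (four-dimensional, with $e_4$ central); - $\mathfrak{R}_2$: $e_1e_2=-e_2e_1=e_2$, $e_3e_4=-e_4e_3=e_4$;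 - $g_4(a,b)$: $e_1e_2=-e_2e_1=e_2$, $e_1e_3=-e_3e_1=e_2+ae_3$, $e_1e_4=-e_4e_1=e_3+be_4$; - $g_5(a)$: $e_1e_2=-e_2e_1=e_2$, $e_1e_3=-e_3e_1=e_2+ae_3$, $e_1e_4=-e_4e_1=(a+1)e_4$, $e_2e_3=-e_3e_2=e_4$. Then the variety $\mathfrak{Lie}_4$ of four-dimensional complex Lie algebras has exactly four irreducible components, namely the (pairwise distinct) sets $$\overline{O(\mathfrak{sl}_2)},\qquad \overline{O(\mathfrak{R}_2)},\qquad \overline{\bigcup_{a\in\mathbb{C}}O(g_5(a))},\qquad \overline{\bigcup_{a,b\in\mathbb{C}}O(g_4(a,b))},$$ and each of these four sets is also an irreducible component of $\mathfrak{Leib}_4$. -/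

import Mathlib

namespace LeibnizVariety

/-- The space `Hom(V ⊗ V, V)` of all algebra structures on `V = ℂⁿ`, that is, of all
bilinear multiplications on `ℂⁿ`. -/
abbrev AlgStr (n : ℕ) : Type :=
  (Fin n → ℂ) →ₗ[ℂ] (Fin n → ℂ) →ₗ[ℂ] (Fin n → ℂ)

/-- The structure constants `c_{ij}^k` of `μ` in the standard basis `e_1, …, e_n` of `ℂⁿ`:
`μ(e_i, e_j) = ∑ k, c_{ij}^k e_k`. The index is the triple `(i, j, k)`. -/
def structConst {n : ℕ} (μ : AlgStr n) (t : Fin n × Fin n × Fin n) : ℂ :=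
  μ (Pi.single t.1 1) (Pi.single t.2.1 1) t.2.2

/-- The set of algebra structures whose structure constants satisfy all the equations `p = 0`,
`p ∈ S`. -/
def zeroSet {n : ℕ} (S : Set (MvPolynomial (Fin n × Fin n × Fin n) ℂ)) : Set (AlgStr n) :=
  {μ | ∀ p ∈ S, MvPolynomial.eval (structConst μ) p = 0}

/-- The Zariski topology on `Hom(V ⊗ V, V)`: a set is closed if and only if it is defined by
a set of polynomial equations in the structure constants. -/
instance zariskiTopology (n : ℕ) : TopologicalSpace (AlgStr n) :=
  TopologicalSpace.ofClosed {Z | ∃ S, Z = zeroSet S}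
    ⟨{1}, by
      ext μ
      simp [zeroSet]⟩
    (by
      intro A hA
      refine ⟨{p | ∃ S, zeroSet S ∈ A ∧ p ∈ S}, ?_⟩
      ext μ
      constructor
      · rintro hμ p ⟨S, hS, hp⟩
        exact hμ _ hS p hp
      · intro hμ Z hZ
        obtain ⟨S, rfl⟩ := hA hZ
        exact fun p hp => hμ p ⟨S, hZ, hp⟩)
    (by
      rintro _ ⟨S, rfl⟩ _ ⟨T, rfl⟩
      refine ⟨{r | ∃ p ∈ S, ∃ q ∈ T, r = p * q}, ?_⟩
      ext μ
      constructor
      · rintro (h | h) _ ⟨p, hp, q, hq, rfl⟩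
        · simp [h p hp]
        · simp [h q hq]
      · intro h
        by_contra hc
        simp only [Set.mem_union, not_or, zeroSet, Set.mem_ofPred_eq, not_forall] at hc
        obtain ⟨⟨p, hp, hp0⟩, ⟨q, hq, hq0⟩⟩ := hc
        have := h (p * q) ⟨p, hp, q, hq, rfl⟩
        rw [map_mul] at this
        exact (mul_ne_zero hp0 hq0) this)

/-- The variety `Leib_n` of Leibniz algebra structures on `ℂⁿ`: `(xy)z = (xz)y + x(yz)`. -/
def Leib (n : ℕ) : Set (AlgStr n) :=
  {μ | ∀ x y z, μ (μ x y) z = μ (μ x z) y + μ x (μ y z)}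

/-- The variety of Lie algebra structures on `ℂⁿ`: `xx = 0` and the Jacobi identity. -/
def LieStr (n : ℕ) : Set (AlgStr n) :=
  {μ | (∀ x, μ x x = 0) ∧ ∀ x y z, μ (μ x y) z + μ (μ y z) x + μ (μ z x) y = 0}

/-- The orbit `O(μ)` under `(g * μ)(x, y) = g μ(g⁻¹ x, g⁻¹ y)`, `g ∈ GL(V)`. -/
def orbit {n : ℕ} (μ : AlgStr n) : Set (AlgStr n) :=
  {ν | ∃ g : (Fin n → ℂ) ≃ₗ[ℂ] (Fin n → ℂ), ∀ x y, ν x y = g (μ (g.symm x) (g.symm y))}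

/-- The irreducible components of a subset `X` of `Hom(V ⊗ V, V)` with its subspace topology,
viewed as subsets of `Hom(V ⊗ V, V)`. -/
def componentsOf {n : ℕ} (X : Set (AlgStr n)) : Set (Set (AlgStr n)) :=
  (fun C : Set X => Subtype.val '' C) '' irreducibleComponents X

/-- The multiplication on `ℂⁿ` with the products of basis vectors `e_i e_j = c i j`. -/
def ofProducts {n : ℕ} (c : Fin n → Fin n → (Fin n → ℂ)) : AlgStr n :=
  LinearMap.mk₂ ℂ (fun x y => ∑ i, ∑ j, (x i * y j) • c i j)
    (by intro x x' y; simp only [Pi.add_apply, add_mul, add_smul, Finset.sum_add_distrib])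
    (by intro a x y; simp only [Pi.smul_apply, smul_eq_mul, Finset.smul_sum, smul_smul, mul_assoc])
    (by intro x y y'; simp only [Pi.add_apply, mul_add, add_smul, Finset.sum_add_distrib])
    (by
      intro a x y
      simp only [Pi.smul_apply, smul_eq_mul, Finset.smul_sum, smul_smul, mul_left_comm])

/-- The anticommutative multiplication on `ℂ⁴` with `e_i e_j = - e_j e_i = b_{ij}` for `i < j`
and `e_i e_i = 0`. -/
def anticomm (b12 b13 b14 b23 b24 b34 : Fin 4 → ℂ) : AlgStr 4 :=
  ofProducts
    ![![0, b12, b13, b14],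
      ![-b12, 0, b23, b24],
      ![-b13, -b23, 0, b34],
      ![-b14, -b24, -b34, 0]]

/-- `e_1 e_2 = e_2`, `e_1 e_3 = -e_3`, `e_2 e_3 = e_1` (so `e_4` is central: the algebra is the
direct sum of the simple Lie algebra `sl_2` and `ℂ`). -/
def sl2 : AlgStr 4 :=
  anticomm ![0, 1, 0, 0] ![0, 0, -1, 0] 0 ![1, 0, 0, 0] 0 0

/-- `e_1 e_2 = e_2`, `e_3 e_4 = e_4`. -/
def R2 : AlgStr 4 :=
  anticomm ![0, 1, 0, 0] 0 0 0 0 ![0, 0, 0, 1]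

/-- `e_1 e_2 = e_2`, `e_1 e_3 = e_2 + a e_3`, `e_1 e_4 = e_3 + b e_4`. -/
def g4 (a b : ℂ) : AlgStr 4 :=
  anticomm ![0, 1, 0, 0] ![0, 1, a, 0] ![0, 0, 1, b] 0 0 0

/-- `e_1 e_2 = e_2`, `e_1 e_3 = e_2 + a e_3`, `e_1 e_4 = (a + 1) e_4`, `e_2 e_3 = e_4`. -/
def g5 (a : ℂ) : AlgStr 4 :=
  anticomm ![0, 1, 0, 0] ![0, 1, a, 0] ![0, 0, 0, a + 1] ![0, 0, 0, 1] 0 0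

end LeibnizVariety

/-! Closures and irreducibility are tested along curves with polynomial structure constants: a
polynomial equation that holds for all but finitely many parameters holds for all. Transport of
structure can be written with the adjugate in place of the inverse, hence polynomially, so two
points of an orbit, or of a family of orbits over an affine space, lie on a common such curve that
stays inside for almost all parameters (`isIrreducible_of_orbit_curves`). The four sets are
therefore closed and irreducible. Three points remain.

Covering (`LieStr_subset_fourFamilies`). A Lie algebra with an abelian ideal of codimension one is
given by a 3×3 matrix; the generic matrix is invertible with a cyclic vector, and then the algebra
is some `g4 a b` (`mem_closure_g4`). Heisenberg ideals of codimension one lead to `g5` in the same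
way (`mem_closure_g5`). If all left multiplications are nilpotent, Engel's theorem produces an
abelian ideal of codimension one. Otherwise the space splits into the Fitting components `H` and `W`
of a non-nilpotent `m x`, and the weights of `m x` for `dim W = 1, 2, 3` force such an ideal or an
isomorphism with `R2` or `sl2`.

No inclusions (`eq_of_lieComponent_subset`). Closed invariant conditions on traces, and
metabelianity, separate the four sets.

Passage to Leibniz algebras (`mem_componentsOf_Leib`). It suffices to find a polynomial, nonzero
somewhere on the component, off which every Leibniz algebra is Lie. Squares are annihilated by all
left multiplications, so a nonzero maximal minor of the stacked left multiplications will do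
(`mem_LieStr_of_det_ne_zero`). This fails for `sl2`, where `e_4` is central; there the polynomial is
a value `tr(R_x R_{yz})` of Cartan's criterion, and `mem_LieStr_of_traceForm_ne_zero` shows that a
nonzero value leaves no room for a nonzero square in dimension four. -/

namespace LeibnizVariety

/-! ### Polynomial curves in the Zariski topology -/

open Polynomial in
/-- The polynomial functions of one complex variable. -/
noncomputable def polyFun : Subalgebra ℂ (ℂ → ℂ) := (aeval (id : ℂ → ℂ)).range

theorem exists_of_mem_polyFun {f : ℂ → ℂ} (hf : f ∈ polyFun) :
    ∃ p : Polynomial ℂ, ∀ t, f t = p.eval t := by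
  obtain ⟨p, rfl⟩ := hf
  exact ⟨p, fun t => by simp [Polynomial.aeval_fn_apply]⟩

theorem id_mem_polyFun : (fun t => t) ∈ polyFun :=
  ⟨Polynomial.X, by simp; rfl⟩

theorem const_mem {X : Type*} (A : Subalgebra ℂ (X → ℂ)) (a : ℂ) : (fun _ => a) ∈ A :=
  A.algebraMap_mem a

theorem finite_zeros_of_mem_polyFun {f : ℂ → ℂ} (hf : f ∈ polyFun) {t₀ : ℂ} (h : f t₀ ≠ 0) :
    {t | f t = 0}.Finite := by
  obtain ⟨p, hp⟩ := exists_of_mem_polyFun hf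
  have : p ≠ 0 := by
    rintro rfl
    exact h (by simp [hp])
  refine (p.roots.toFinset.finite_toSet).subset fun t ht => ?_
  simpa [this, Polynomial.IsRoot, hp] using ht

theorem eq_zero_of_mem_polyFun {f : ℂ → ℂ} (hf : f ∈ polyFun) {B : Set ℂ} (hB : B.Finite)
    (h : ∀ t ∉ B, f t = 0) (t : ℂ) : f t = 0 := by
  by_contra ht
  have := (finite_zeros_of_mem_polyFun hf ht).union hB
  refine Set.infinite_univ (this.subset fun s _ => ?_)
  by_cases hs : s ∈ B
  · exact Or.inr hs
  · exact Or.inl (h s hs)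

theorem apply_eq_sum {n : ℕ} (m : AlgStr n) (x y : Fin n → ℂ) (k : Fin n) :
    m x y k = ∑ i, ∑ j, x i * y j * structConst m (i, j, k) := by
  conv_lhs => rw [← Finset.univ_sum_single x, ← Finset.univ_sum_single y]
  have hs : ∀ (z : Fin n → ℂ) (i : Fin n),
      (Pi.single i (z i) : Fin n → ℂ) = z i • Pi.single i (1 : ℂ) := by
    intro z i
    rw [← Pi.single_smul]; simp
  simp only [hs, map_sum, LinearMap.sum_apply, map_smul, LinearMap.smul_apply, Finset.sum_apply,
    Pi.smul_apply, smul_eq_mul, structConst, Finset.mul_sum]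
  rw [Finset.sum_comm]
  refine Finset.sum_congr rfl fun i _ => Finset.sum_congr rfl fun j _ => ?_
  ring

/-- If the structure constants of `c s` and the coordinates of `u s`, `v s` lie in an algebra of
functions of `s`, then so do the coordinates of the product. -/
theorem coord_mem {n : ℕ} {X : Type*} (A : Subalgebra ℂ (X → ℂ)) {c : X → AlgStr n}
    (hc : ∀ t, (fun s => structConst (c s) t) ∈ A) {u v : X → Fin n → ℂ}
    (hu : ∀ i, (fun s => u s i) ∈ A) (hv : ∀ i, (fun s => v s i) ∈ A) (k : Fin n) :
    (fun s => c s (u s) (v s) k) ∈ A := by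
  have : (fun s => c s (u s) (v s) k) =
      ∑ i, ∑ j, (fun s => u s i) * (fun s => v s j) * (fun s => structConst (c s) (i, j, k)) := by
    ext s
    simp [apply_eq_sum]
  rw [this]
  exact sum_mem fun i _ => sum_mem fun j _ => mul_mem (mul_mem (hu i) (hv j)) (hc _)

theorem mulVec_mem {n : ℕ} {X : Type*} (A : Subalgebra ℂ (X → ℂ))
    {G : X → Matrix (Fin n) (Fin n) ℂ} (hG : ∀ i j, (fun s => G s i j) ∈ A) {u : X → Fin n → ℂ}
    (hu : ∀ i, (fun s => u s i) ∈ A) (k : Fin n) : (fun s => (G s).mulVec (u s) k) ∈ A := by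
  have : (fun s => (G s).mulVec (u s) k) = ∑ i, (fun s => G s k i) * (fun s => u s i) := by
    ext s
    simp [Matrix.mulVec, dotProduct]
  rw [this]
  exact sum_mem fun i _ => mul_mem (hG _ _) (hu _)

theorem det_mem {n : ℕ} {X : Type*} (A : Subalgebra ℂ (X → ℂ))
    {G : X → Matrix (Fin n) (Fin n) ℂ} (hG : ∀ i j, (fun s => G s i j) ∈ A) :
    (fun s => (G s).det) ∈ A := by
  have : (fun s => (G s).det) = ∑ σ : Equiv.Perm (Fin n),
      (fun _ => ((Equiv.Perm.sign σ : ℤ) : ℂ)) * ∏ i, fun s => G s (σ i) i := by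
    ext s
    simp [Matrix.det_apply']
  rw [this]
  exact sum_mem fun σ _ => mul_mem (const_mem A _) (prod_mem fun i _ => hG _ _)

theorem adjugate_mem {n : ℕ} {X : Type*} (A : Subalgebra ℂ (X → ℂ))
    {G : X → Matrix (Fin n) (Fin n) ℂ} (hG : ∀ i j, (fun s => G s i j) ∈ A) (i j : Fin n) :
    (fun s => (G s).adjugate i j) ∈ A := by
  simp only [Matrix.adjugate_apply]
  refine det_mem A fun k l => ?_
  by_cases h : k = j
  · subst h
    simp only [Matrix.updateRow_self]
    exact const_mem A _
  · simp only [Matrix.updateRow_ne h]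
    exact hG _ _

/-- A curve of algebra structures whose structure constants are polynomials. -/
def PolyCurve {n : ℕ} (c : ℂ → AlgStr n) : Prop :=
  ∀ t, (fun s => structConst (c s) t) ∈ polyFun

theorem polyCurve_const {n : ℕ} (m : AlgStr n) : PolyCurve fun _ => m :=
  fun _ => const_mem _ _

theorem PolyCurve.eval_mem {n : ℕ} {c : ℂ → AlgStr n} (hc : PolyCurve c)
    (P : MvPolynomial (Fin n × Fin n × Fin n) ℂ) :
    (fun s => MvPolynomial.eval (structConst (c s)) P) ∈ polyFun := by
  induction P using MvPolynomial.induction_on with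
  | C a => simpa using const_mem polyFun a
  | add p q hp hq => simpa only [map_add] using! add_mem hp hq
  | mul_X p i hp => simpa only [map_mul, MvPolynomial.eval_X] using! mul_mem hp (hc i)

theorem isClosed_iff {n : ℕ} {Z : Set (AlgStr n)} : IsClosed Z ↔ ∃ S, Z = zeroSet S := by
  rw [← isOpen_compl_iff]
  change Zᶜᶜ ∈ {Z | ∃ S, Z = zeroSet S} ↔ _
  rw [compl_compl]; rfl

theorem exists_of_not_mem {n : ℕ} {Z : Set (AlgStr n)} (hZ : IsClosed Z) {m : AlgStr n}
    (hm : m ∉ Z) : ∃ P, (∀ m' ∈ Z, MvPolynomial.eval (structConst m') P = 0) ∧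
      MvPolynomial.eval (structConst m) P ≠ 0 := by
  obtain ⟨S, rfl⟩ := isClosed_iff.1 hZ
  simp only [zeroSet, Set.mem_ofPred_eq, not_forall] at hm
  obtain ⟨P, hP, h⟩ := hm
  exact ⟨P, fun m' h' => h' P hP, h⟩

theorem mem_closure_of_curve {n : ℕ} {c : ℂ → AlgStr n} (hc : PolyCurve c) {S : Set (AlgStr n)}
    {B : Set ℂ} (hB : B.Finite) (h : ∀ t ∉ B, c t ∈ closure S) (t : ℂ) : c t ∈ closure S := by
  by_contra ht
  obtain ⟨P, hP, hP'⟩ := exists_of_not_mem isClosed_closure ht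
  exact hP' (eq_zero_of_mem_polyFun (hc.eval_mem P) hB (fun s hs => hP _ (h s hs)) t)

/-- If two closed sets covered `S` and each missed a point, take a polynomial for each that vanishes
on the set but not at the missed point. On a curve through both points each polynomial has finitely
many zeros, yet almost every point of the curve must be a zero of one of them. -/
theorem isIrreducible_of_curves {n : ℕ} {S : Set (AlgStr n)} (hS : S.Nonempty)
    (h : ∀ m₀ ∈ S, ∀ m₁ ∈ S, ∃ c, PolyCurve c ∧ c 0 = m₀ ∧ c 1 = m₁ ∧
      ∃ B : Set ℂ, B.Finite ∧ ∀ t ∉ B, c t ∈ S) : IsIrreducible S := by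
  refine ⟨hS, isPreirreducible_iff_isClosed_union_isClosed.2 fun Z₁ Z₂ h₁ h₂ hsub => ?_⟩
  by_contra hcon
  simp only [not_or, Set.not_subset] at hcon
  obtain ⟨⟨m₀, hm₀, h₀⟩, ⟨m₁, hm₁, h₁'⟩⟩ := hcon
  obtain ⟨c, hc, rfl, rfl, B, hB, hcB⟩ := h m₀ hm₀ m₁ hm₁
  obtain ⟨P, hP, hP'⟩ := exists_of_not_mem h₁ h₀
  obtain ⟨Q, hQ, hQ'⟩ := exists_of_not_mem h₂ h₁'
  have hfin := hB.union ((finite_zeros_of_mem_polyFun (hc.eval_mem P) hP').union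
    (finite_zeros_of_mem_polyFun (hc.eval_mem Q) hQ'))
  refine Set.infinite_univ (hfin.subset fun s _ => ?_)
  by_cases hs : s ∈ B
  · exact Or.inl hs
  · rcases hsub (hcB s hs) with h' | h'
    · exact Or.inr (Or.inl (hP _ h'))
    · exact Or.inr (Or.inr (hQ _ h'))

/-! ### Orbits and their irreducibility -/

theorem mem_orbit_self {n : ℕ} (m : AlgStr n) : m ∈ orbit m :=
  ⟨LinearEquiv.refl ℂ _, fun _ _ => rfl⟩

theorem mem_orbit_trans {n : ℕ} {m₁ m₂ m₃ : AlgStr n} (h₁ : m₁ ∈ orbit m₂) (h₂ : m₂ ∈ orbit m₃) :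
    m₁ ∈ orbit m₃ := by
  obtain ⟨g, hg⟩ := h₁
  obtain ⟨h, hh⟩ := h₂
  exact ⟨h.trans g, fun x y => by simp [hg, hh]⟩

/-- Transport of structure by the matrix `G`, up to the factor `(det G)²`. -/
noncomputable def adjConj {n : ℕ} (G : Matrix (Fin n) (Fin n) ℂ) (m : AlgStr n) : AlgStr n :=
  (m.compl₁₂ G.adjugate.mulVecLin G.adjugate.mulVecLin).compr₂ G.mulVecLin

theorem adjConj_apply {n : ℕ} (G : Matrix (Fin n) (Fin n) ℂ) (m : AlgStr n) (x y : Fin n → ℂ) :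
    adjConj G m x y = G.mulVec (m (G.adjugate.mulVec x) (G.adjugate.mulVec y)) := rfl

/-- `adjConj G m` is `(det G)²` times the transport of `m` by `G`, and a nonzero multiple `c • μ` is
the transport of `μ` by the scalar `c⁻¹`. Hence the isomorphism is `(det G)⁻² G`. -/
theorem adjConj_mem_orbit {n : ℕ} {G : Matrix (Fin n) (Fin n) ℂ} (hG : G.det ≠ 0) (m : AlgStr n) :
    adjConj G m ∈ orbit m := by
  let g : (Fin n → ℂ) ≃ₗ[ℂ] (Fin n → ℂ) := LinearEquiv.ofLinearMap
    ((G.det ^ 2)⁻¹ • G.mulVecLin) (G.det • G.adjugate.mulVecLin)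
    (by
      refine LinearMap.ext fun x => ?_
      simp only [LinearMap.comp_apply, LinearMap.smul_apply, Matrix.mulVecLin_apply,
        Matrix.mulVec_smul, Matrix.mulVec_mulVec, Matrix.mul_adjugate, Matrix.smul_mulVec,
        Matrix.one_mulVec, smul_smul, LinearMap.id_apply]
      rw [show (G.det ^ 2)⁻¹ * (G.det * G.det) = 1 by field_simp]
      simp)
    (by
      refine LinearMap.ext fun x => ?_
      simp only [LinearMap.comp_apply, LinearMap.smul_apply, Matrix.mulVecLin_apply,
        Matrix.mulVec_smul, Matrix.mulVec_mulVec, Matrix.adjugate_mul, Matrix.smul_mulVec,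
        Matrix.one_mulVec, smul_smul, LinearMap.id_apply]
      rw [show G.det * ((G.det ^ 2)⁻¹ * G.det) = 1 by field_simp]
      simp)
  refine ⟨g, fun x y => ?_⟩
  change _ = (G.det ^ 2)⁻¹ • G.mulVec (m (G.det • G.adjugate.mulVec x) (G.det • G.adjugate.mulVec y))
  simp only [map_smul, LinearMap.smul_apply, Matrix.mulVec_smul, smul_smul, adjConj_apply]
  rw [show (G.det ^ 2)⁻¹ * (G.det * G.det) = 1 by field_simp, one_smul]

theorem exists_adjConj {m m' : AlgStr 4} (h : m' ∈ orbit m) :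
    ∃ G : Matrix (Fin 4) (Fin 4) ℂ, G.det ≠ 0 ∧ m' = adjConj G m := by
  obtain ⟨g, hg⟩ := h
  let H : Matrix (Fin 4) (Fin 4) ℂ := LinearMap.toMatrix' g.toLinearMap
  have hH : ∀ x, H.mulVec x = g x := fun x => by
    simp [H, LinearMap.toMatrix'_mulVec]
  have hdet : H.det ≠ 0 := by
    rw [LinearMap.det_toMatrix']
    exact (LinearEquiv.isUnit_det' g).ne_zero
  -- The adjugate of a 4×4 matrix is cubic, so replacing `H` by `a • H` multiplies `adjConj H m` by
  -- `a³ · a³ · a = a⁷`. This `a` cancels the factor `(det H)²`.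
  obtain ⟨a, ha⟩ := IsAlgClosed.exists_pow_nat_eq ((H.det ^ 2)⁻¹) (n := 7) (by norm_num)
  have ha0 : a ≠ 0 := by
    rintro rfl
    have : (H.det ^ 2)⁻¹ ≠ 0 := inv_ne_zero (pow_ne_zero _ hdet)
    exact this (by rw [← ha]; simp)
  have hadj : ∀ x, H.adjugate.mulVec x = H.det • g.symm x := fun x => by
    conv_lhs => rw [← g.apply_symm_apply x, ← hH]
    simp [Matrix.mulVec_mulVec, Matrix.adjugate_mul, Matrix.smul_mulVec]
  refine ⟨a • H, ?_, ?_⟩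
  · simp [ha0, hdet]
  · refine LinearMap.ext₂ fun x y => ?_
    rw [adjConj_apply, hg, Matrix.adjugate_smul]
    simp only [Matrix.smul_mulVec, hadj, map_smul, LinearMap.smul_apply, Matrix.mulVec_smul,
      hH, smul_smul]
    rw [show a ^ (Fintype.card (Fin 4) - 1) * H.det * (a ^ (Fintype.card (Fin 4) - 1) * H.det) * a =
      a ^ 7 * H.det ^ 2 by simp only [Fintype.card_fin]; ring, ha,
      inv_mul_cancel₀ (pow_ne_zero 2 hdet), one_smul]

theorem polyCurve_adjConj {n : ℕ} {c : ℂ → AlgStr n} (hc : PolyCurve c)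
    {G : ℂ → Matrix (Fin n) (Fin n) ℂ} (hG : ∀ i j, (fun s => G s i j) ∈ polyFun) :
    PolyCurve fun s => adjConj (G s) (c s) := by
  intro t
  have hu : ∀ x : Fin n → ℂ, ∀ i, (fun s => (G s).adjugate.mulVec x i) ∈ polyFun := fun x =>
    mulVec_mem _ (adjugate_mem _ hG) fun i => const_mem _ (x i)
  exact mulVec_mem polyFun hG (u := fun s => c s ((G s).adjugate.mulVec (Pi.single t.1 1))
    ((G s).adjugate.mulVec (Pi.single t.2.1 1))) (coord_mem polyFun hc (hu _) (hu _)) t.2.2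

/-- Move the base point along `c` and, simultaneously, the transporting matrix along the line from
`G₀` to `G₁`. Its determinant is a polynomial that is nonzero at `0`, so only finitely many
parameters are lost. -/
theorem isIrreducible_of_orbit_curves {S : Set (AlgStr 4)} (hS : S.Nonempty)
    (h : ∀ m₀ ∈ S, ∀ m₁ ∈ S, ∃ c, PolyCurve c ∧ m₀ ∈ orbit (c 0) ∧ m₁ ∈ orbit (c 1) ∧
      ∀ t, orbit (c t) ⊆ S) : IsIrreducible S := by
  refine isIrreducible_of_curves hS fun m₀ h₀ m₁ h₁ => ?_
  obtain ⟨c, hc, hc₀, hc₁, hcS⟩ := h m₀ h₀ m₁ h₁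
  obtain ⟨G₀, hG₀, e₀⟩ := exists_adjConj hc₀
  obtain ⟨G₁, hG₁, e₁⟩ := exists_adjConj hc₁
  let G : ℂ → Matrix (Fin 4) (Fin 4) ℂ := fun s => G₀ + s • (G₁ - G₀)
  have hG : ∀ i j, (fun s => G s i j) ∈ polyFun := fun i j =>
    add_mem (const_mem polyFun (G₀ i j)) (mul_mem id_mem_polyFun (const_mem polyFun _))
  refine ⟨_, polyCurve_adjConj hc hG, ?_, ?_, {s | (G s).det = 0}, ?_, ?_⟩
  · simp [G, e₀]
  · simp [G, e₁]
  · exact finite_zeros_of_mem_polyFun (det_mem _ hG) (t₀ := 0) (by simpa [G] using hG₀)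
  · intro t ht
    exact hcS t (adjConj_mem_orbit ht _)

theorem isIrreducible_orbit (m : AlgStr 4) : IsIrreducible (orbit m) :=
  isIrreducible_of_orbit_curves ⟨m, mem_orbit_self m⟩ fun _ h₀ _ h₁ =>
    ⟨fun _ => m, polyCurve_const m, h₀, h₁, fun _ => subset_rfl⟩

/-! ### Regular functions and irreducible components -/

/-- The polynomial functions of the structure constants. -/
noncomputable def regFun (n : ℕ) : Subalgebra ℂ (AlgStr n → ℂ) :=
  (MvPolynomial.aeval fun t m => structConst m t).range

theorem structConst_mem_regFun {n : ℕ} (t : Fin n × Fin n × Fin n) :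
    (fun m : AlgStr n => structConst m t) ∈ regFun n :=
  ⟨MvPolynomial.X t, by simp⟩

theorem apply_mem_regFun {n : ℕ} {u v : AlgStr n → Fin n → ℂ}
    (hu : ∀ i, (fun s => u s i) ∈ regFun n) (hv : ∀ i, (fun s => v s i) ∈ regFun n) (k : Fin n) :
    (fun m : AlgStr n => m (u m) (v m) k) ∈ regFun n :=
  coord_mem _ (c := fun m => m) structConst_mem_regFun hu hv k

theorem isClosed_of_regFun {n : ℕ} {F : AlgStr n → ℂ} (hF : F ∈ regFun n) :
    IsClosed {m | F m = 0} := by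
  obtain ⟨p, rfl⟩ := hF
  refine isClosed_iff.2 ⟨{p}, ?_⟩
  ext m
  have : (MvPolynomial.aeval (fun t (m : AlgStr n) => structConst m t)) p m =
      MvPolynomial.eval (structConst m) p := by
    induction p using MvPolynomial.induction_on with
    | C a => simp
    | add p q hp hq => simp [hp, hq]
    | mul_X p i hp => simp [hp]
  simpa [zeroSet] using Iff.of_eq (congrArg (· = 0) this)

/-- Irreducibility of a subset of `X` may be tested in the ambient space, because the open sets of
`X` are traces of ambient ones. -/
theorem mem_componentsOf {n : ℕ} {X C : Set (AlgStr n)} : C ∈ componentsOf X ↔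
    C ⊆ X ∧ IsIrreducible C ∧ ∀ D ⊆ X, IsIrreducible D → C ⊆ D → D ⊆ C := by
  have key : ∀ D : Set X, IsIrreducible D ↔ IsIrreducible (Subtype.val '' D) := by
    refine fun D => ⟨fun h => h.image _ continuous_subtype_val.continuousOn, fun h => ?_⟩
    refine ⟨by simpa using h.1, ?_⟩
    rintro _ _ ⟨U, hU, rfl⟩ ⟨V, hV, rfl⟩ ⟨x, hx, hxU⟩ ⟨y, hy, hyV⟩
    obtain ⟨_, ⟨z, hz, rfl⟩, hzU, hzV⟩ := h.2 U V hU hV ⟨x, ⟨x, hx, rfl⟩, hxU⟩ ⟨y, ⟨y, hy, rfl⟩, hyV⟩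
    exact ⟨z, hz, hzU, hzV⟩
  constructor
  · rintro ⟨C, hC, rfl⟩
    refine ⟨by simp, (key C).1 hC.1, fun D hD hD' hCD => ?_⟩
    obtain ⟨D, rfl⟩ : ∃ D' : Set X, Subtype.val '' D' = D :=
      ⟨Subtype.val ⁻¹' D, by simpa [Subtype.image_preimage_coe] using hD⟩
    refine Set.image_mono (hC.2 ((key D).2 hD') ?_)
    exact (Set.image_subset_image_iff Subtype.val_injective).1 hCD
  · rintro ⟨hCX, hC, hmax⟩
    obtain ⟨C, rfl⟩ : ∃ C' : Set X, Subtype.val '' C' = C :=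
      ⟨Subtype.val ⁻¹' C, by simpa [Subtype.image_preimage_coe] using hCX⟩
    refine ⟨C, ⟨(key C).2 hC, fun D hD hCD => ?_⟩, rfl⟩
    have := hmax (Subtype.val '' D) (by simp) ((key D).1 hD) (Set.image_mono hCD)
    rwa [Set.image_subset_image_iff Subtype.val_injective] at this

/-! ### Coordinates of the four multiplications -/

theorem anticomm_apply (b12 b13 b14 b23 b24 b34 x y : Fin 4 → ℂ) :
    anticomm b12 b13 b14 b23 b24 b34 x y =
      (x 0 * y 1 - x 1 * y 0) • b12 + (x 0 * y 2 - x 2 * y 0) • b13 +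
      (x 0 * y 3 - x 3 * y 0) • b14 + (x 1 * y 2 - x 2 * y 1) • b23 +
      (x 1 * y 3 - x 3 * y 1) • b24 + (x 2 * y 3 - x 3 * y 2) • b34 := by
  simp only [anticomm, ofProducts, LinearMap.mk₂_apply, Fin.sum_univ_four]
  ext k
  simp
  ring

theorem g4_apply (a b : ℂ) (x y : Fin 4 → ℂ) : g4 a b x y =
    ![0, (x 0 * y 1 - x 1 * y 0) + (x 0 * y 2 - x 2 * y 0),
      a * (x 0 * y 2 - x 2 * y 0) + (x 0 * y 3 - x 3 * y 0), b * (x 0 * y 3 - x 3 * y 0)] := by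
  rw [g4, anticomm_apply]
  ext k
  fin_cases k <;> simp <;> ring

theorem g5_apply (a : ℂ) (x y : Fin 4 → ℂ) : g5 a x y =
    ![0, (x 0 * y 1 - x 1 * y 0) + (x 0 * y 2 - x 2 * y 0), a * (x 0 * y 2 - x 2 * y 0),
      (a + 1) * (x 0 * y 3 - x 3 * y 0) + (x 1 * y 2 - x 2 * y 1)] := by
  rw [g5, anticomm_apply]
  ext k
  fin_cases k <;> simp <;> ring

theorem sl2_apply (x y : Fin 4 → ℂ) : sl2 x y =
    ![x 1 * y 2 - x 2 * y 1, x 0 * y 1 - x 1 * y 0, -(x 0 * y 2 - x 2 * y 0), 0] := by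
  rw [sl2, anticomm_apply]
  ext k
  fin_cases k <;> simp

theorem R2_apply (x y : Fin 4 → ℂ) : R2 x y =
    ![0, x 0 * y 1 - x 1 * y 0, 0, x 2 * y 3 - x 3 * y 2] := by
  rw [R2, anticomm_apply]
  ext k
  fin_cases k <;> simp

/-! ### Closed invariant conditions that separate the four sets -/

/-- Right multiplication by `x`. -/
def rmul {n : ℕ} (m : AlgStr n) (x : Fin n → ℂ) : Module.End ℂ (Fin n → ℂ) := m.flip x

theorem trace_eq_sum {n : ℕ} (f : Module.End ℂ (Fin n → ℂ)) :
    LinearMap.trace ℂ _ f = ∑ i, f (Pi.single i 1) i := by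
  rw [LinearMap.trace_eq_matrix_trace ℂ (Pi.basisFun ℂ (Fin n)), Matrix.trace]
  simp

theorem trace_mem {n : ℕ} {f : AlgStr n → Module.End ℂ (Fin n → ℂ)}
    (hf : ∀ v : Fin n → ℂ, ∀ i, (fun m => f m v i) ∈ regFun n) :
    (fun m => LinearMap.trace ℂ _ (f m)) ∈ regFun n := by
  simp only [trace_eq_sum]
  have : (fun m => ∑ i, f m (Pi.single i 1) i) = ∑ i, fun m => f m (Pi.single i 1) i := by
    ext m
    simp
  rw [this]
  exact sum_mem fun i _ => hf _ _

theorem const_vec_mem {n : ℕ} (v : Fin n → ℂ) (i : Fin n) :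
    (fun _ : AlgStr n => v i) ∈ regFun n := const_mem _ _

theorem trace_lmul_mem {n : ℕ} (x : Fin n → ℂ) :
    (fun m : AlgStr n => LinearMap.trace ℂ _ (m x)) ∈ regFun n :=
  trace_mem fun v => apply_mem_regFun (const_vec_mem x) (const_vec_mem v)

theorem trace_lmul_lmul_mem {n : ℕ} (x y : Fin n → ℂ) :
    (fun m : AlgStr n => LinearMap.trace ℂ _ (m x ∘ₗ m y)) ∈ regFun n :=
  trace_mem fun v => apply_mem_regFun (const_vec_mem x)
    (apply_mem_regFun (const_vec_mem y) (const_vec_mem v))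

theorem trace_lmul_lmul_lmul_mem {n : ℕ} (x : Fin n → ℂ) :
    (fun m : AlgStr n => LinearMap.trace ℂ _ (m x ∘ₗ m x ∘ₗ m x)) ∈ regFun n :=
  trace_mem fun v => apply_mem_regFun (const_vec_mem x) (apply_mem_regFun (const_vec_mem x)
    (apply_mem_regFun (const_vec_mem x) (const_vec_mem v)))

theorem isClosed_of_forall {n : ℕ} {ι : Type*} {F : ι → AlgStr n → ℂ}
    (hF : ∀ i, F i ∈ regFun n) : IsClosed {m | ∀ i, F i m = 0} := by
  rw [Set.ofPred_forall]
  exact isClosed_iInter fun i => isClosed_of_regFun (hF i)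

theorem isClosed_of_forall_vec {n : ℕ} {ι : Type*} {F : ι → AlgStr n → Fin n → ℂ}
    (hF : ∀ i k, (fun m => F i m k) ∈ regFun n) : IsClosed {m | ∀ i, F i m = 0} := by
  have : {m | ∀ i, F i m = 0} = {m | ∀ p : ι × Fin n, F p.1 m p.2 = 0} := by
    ext m
    simp [funext_iff]
  rw [this]
  exact isClosed_of_forall fun p => hF p.1 p.2

/-- Structures with `tr L_x = 0` for all left multiplications. -/
def unimodular (n : ℕ) : Set (AlgStr n) := {m | ∀ x, LinearMap.trace ℂ _ (m x) = 0}

/-- Structures satisfying Cartan's trace criterion for solvability, for right multiplications. -/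
def traceSolvable (n : ℕ) : Set (AlgStr n) :=
  {m | ∀ x y z, LinearMap.trace ℂ _ (rmul m x ∘ₗ rmul m (m y z)) = 0}

/-- Structures whose trace function and trace form are proportional to one linear form and its
square. -/
def traceProportional (n : ℕ) : Set (AlgStr n) :=
  {m | ∀ x y z, LinearMap.trace ℂ _ (m x) * LinearMap.trace ℂ _ (m y ∘ₗ m z) =
    LinearMap.trace ℂ _ (m y) * LinearMap.trace ℂ _ (m x ∘ₗ m z)}

/-- Metabelian structures. -/
def metabelian (n : ℕ) : Set (AlgStr n) := {m | ∀ x y z w, m (m x y) (m z w) = 0}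

/-- The third elementary symmetric function of the eigenvalues of left multiplications vanishes. -/
def thirdSymmZero (n : ℕ) : Set (AlgStr n) :=
  {m | ∀ x, LinearMap.trace ℂ _ (m x) ^ 3 -
    3 * LinearMap.trace ℂ _ (m x) * LinearMap.trace ℂ _ (m x ∘ₗ m x) +
    2 * LinearMap.trace ℂ _ (m x ∘ₗ m x ∘ₗ m x) = 0}

/-- One of the eigenvalues of a left multiplication is the sum of the others, as a condition on
power sums (for three eigenvalues apart from zero). -/
def eigenvalueSum (n : ℕ) : Set (AlgStr n) :=
  {m | ∀ x, -LinearMap.trace ℂ _ (m x) ^ 3 +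
    6 * LinearMap.trace ℂ _ (m x) * LinearMap.trace ℂ _ (m x ∘ₗ m x) -
    8 * LinearMap.trace ℂ _ (m x ∘ₗ m x ∘ₗ m x) = 0}

theorem isClosed_unimodular (n : ℕ) : IsClosed (unimodular n) :=
  isClosed_of_forall fun x => trace_lmul_mem x

theorem isClosed_traceSolvable (n : ℕ) : IsClosed (traceSolvable n) := by
  have := isClosed_of_forall
    (F := fun (p : (Fin n → ℂ) × (Fin n → ℂ) × (Fin n → ℂ)) (m : AlgStr n) =>
      LinearMap.trace ℂ _ (rmul m p.1 ∘ₗ rmul m (m p.2.1 p.2.2))) fun p => trace_mem fun v =>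
        apply_mem_regFun (apply_mem_regFun (const_vec_mem v)
          (apply_mem_regFun (const_vec_mem p.2.1) (const_vec_mem p.2.2))) (const_vec_mem p.1)
  simpa [traceSolvable] using this

theorem isClosed_traceProportional (n : ℕ) : IsClosed (traceProportional n) := by
  have := isClosed_of_forall
    (F := fun (p : (Fin n → ℂ) × (Fin n → ℂ) × (Fin n → ℂ)) (m : AlgStr n) =>
      LinearMap.trace ℂ _ (m p.1) * LinearMap.trace ℂ _ (m p.2.1 ∘ₗ m p.2.2) -
      LinearMap.trace ℂ _ (m p.2.1) * LinearMap.trace ℂ _ (m p.1 ∘ₗ m p.2.2)) fun p =>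
      sub_mem (mul_mem (trace_lmul_mem p.1) (trace_lmul_lmul_mem p.2.1 p.2.2))
        (mul_mem (trace_lmul_mem p.2.1) (trace_lmul_lmul_mem p.1 p.2.2))
  simpa [traceProportional, sub_eq_zero] using this

theorem isClosed_metabelian (n : ℕ) : IsClosed (metabelian n) := by
  have := isClosed_of_forall_vec
    (F := fun (p : (Fin n → ℂ) × (Fin n → ℂ) × (Fin n → ℂ) × (Fin n → ℂ)) (m : AlgStr n) =>
      m (m p.1 p.2.1) (m p.2.2.1 p.2.2.2)) fun p => apply_mem_regFun
        (apply_mem_regFun (const_vec_mem p.1) (const_vec_mem p.2.1))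
        (apply_mem_regFun (const_vec_mem p.2.2.1) (const_vec_mem p.2.2.2))
  simpa [metabelian] using this

theorem isClosed_thirdSymmZero (n : ℕ) : IsClosed (thirdSymmZero n) :=
  isClosed_of_forall fun x => add_mem (sub_mem (pow_mem (trace_lmul_mem x) 3)
    (mul_mem (mul_mem (const_mem _ 3) (trace_lmul_mem x)) (trace_lmul_lmul_mem x x)))
    (mul_mem (const_mem _ 2) (trace_lmul_lmul_lmul_mem x))

theorem isClosed_eigenvalueSum (n : ℕ) : IsClosed (eigenvalueSum n) :=
  isClosed_of_forall fun x => sub_mem (add_mem (neg_mem (pow_mem (trace_lmul_mem x) 3))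
    (mul_mem (mul_mem (const_mem _ 6) (trace_lmul_mem x)) (trace_lmul_lmul_mem x x)))
    (mul_mem (const_mem _ 8) (trace_lmul_lmul_lmul_mem x))

theorem isClosed_LieStr (n : ℕ) : IsClosed (LieStr n) := by
  have h₁ := isClosed_of_forall_vec (F := fun (x : Fin n → ℂ) (m : AlgStr n) => m x x)
    fun x => apply_mem_regFun (const_vec_mem x) (const_vec_mem x)
  have h₂ := isClosed_of_forall_vec
    (F := fun (p : (Fin n → ℂ) × (Fin n → ℂ) × (Fin n → ℂ)) (m : AlgStr n) =>
      m (m p.1 p.2.1) p.2.2 + m (m p.2.1 p.2.2) p.1 + m (m p.2.2 p.1) p.2.1) fun p k =>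
      add_mem (add_mem
        (apply_mem_regFun (apply_mem_regFun (const_vec_mem p.1) (const_vec_mem p.2.1))
          (const_vec_mem p.2.2) k)
        (apply_mem_regFun (apply_mem_regFun (const_vec_mem p.2.1) (const_vec_mem p.2.2))
          (const_vec_mem p.1) k))
        (apply_mem_regFun (apply_mem_regFun (const_vec_mem p.2.2) (const_vec_mem p.1))
          (const_vec_mem p.2.1) k)
  simpa [LieStr, Set.ofPred_and] using h₁.inter h₂

theorem exists_conj_of_mem_orbit {n : ℕ} {m m' : AlgStr n} (h : m' ∈ orbit m) :
    ∃ g : (Fin n → ℂ) ≃ₗ[ℂ] (Fin n → ℂ), (∀ x y, m' x y = g (m (g.symm x) (g.symm y))) ∧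
      (∀ x, m' x = g.conj (m (g.symm x))) ∧ ∀ x, rmul m' x = g.conj (rmul m (g.symm x)) := by
  obtain ⟨g, hg⟩ := h
  refine ⟨g, hg, fun x => LinearMap.ext fun y => ?_, fun x => LinearMap.ext fun y => ?_⟩
  · simp [hg, LinearEquiv.conj_apply]
  · simp [hg, LinearEquiv.conj_apply, rmul]

theorem orbit_subset_unimodular {n : ℕ} {m : AlgStr n} (h : m ∈ unimodular n) :
    orbit m ⊆ unimodular n := by
  intro m' hm' x
  obtain ⟨g, -, hl, -⟩ := exists_conj_of_mem_orbit hm'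
  rw [hl, LinearMap.trace_conj']
  exact h _

theorem orbit_subset_traceSolvable {n : ℕ} {m : AlgStr n} (h : m ∈ traceSolvable n) :
    orbit m ⊆ traceSolvable n := by
  intro m' hm' x y z
  obtain ⟨g, hg, -, hr⟩ := exists_conj_of_mem_orbit hm'
  rw [hr, hr, ← LinearEquiv.conj_comp, LinearMap.trace_conj', hg, LinearEquiv.symm_apply_apply]
  exact h _ _ _

theorem orbit_subset_traceProportional {n : ℕ} {m : AlgStr n} (h : m ∈ traceProportional n) :
    orbit m ⊆ traceProportional n := by
  intro m' hm' x y z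
  obtain ⟨g, -, hl, -⟩ := exists_conj_of_mem_orbit hm'
  simp only [hl, ← LinearEquiv.conj_comp, LinearMap.trace_conj']
  exact h _ _ _

theorem orbit_subset_metabelian {n : ℕ} {m : AlgStr n} (h : m ∈ metabelian n) :
    orbit m ⊆ metabelian n := by
  rintro m' ⟨g, hg⟩ x y z w
  simp [hg, h _ _ _ _]

theorem orbit_subset_thirdSymmZero {n : ℕ} {m : AlgStr n} (h : m ∈ thirdSymmZero n) :
    orbit m ⊆ thirdSymmZero n := by
  intro m' hm' x
  obtain ⟨g, -, hl, -⟩ := exists_conj_of_mem_orbit hm'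
  simp only [hl, ← LinearEquiv.conj_comp, LinearMap.trace_conj']
  exact h _

theorem orbit_subset_eigenvalueSum {n : ℕ} {m : AlgStr n} (h : m ∈ eigenvalueSum n) :
    orbit m ⊆ eigenvalueSum n := by
  intro m' hm' x
  obtain ⟨g, -, hl, -⟩ := exists_conj_of_mem_orbit hm'
  simp only [hl, ← LinearEquiv.conj_comp, LinearMap.trace_conj']
  exact h _

theorem orbit_subset_LieStr {n : ℕ} {m : AlgStr n} (h : m ∈ LieStr n) :
    orbit m ⊆ LieStr n := by
  rintro m' ⟨g, hg⟩
  refine ⟨fun x => by simp [hg, h.1], fun x y z => ?_⟩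
  simp only [hg, LinearEquiv.symm_apply_apply, ← map_add, h.2, map_zero]

theorem sl2_mem_LieStr : sl2 ∈ LieStr 4 := by
  constructor <;> intros <;> ext k <;> fin_cases k <;> simp [sl2_apply] <;> ring

theorem R2_mem_LieStr : R2 ∈ LieStr 4 := by
  constructor <;> intros <;> ext k <;> fin_cases k <;> simp [R2_apply] <;> ring

theorem g5_mem_LieStr (a : ℂ) : g5 a ∈ LieStr 4 := by
  refine ⟨fun x => ?_, fun x y z => ?_⟩ <;> ext k <;> fin_cases k
  all_goals simp [g5_apply, mul_comm]
  all_goals ring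

theorem g4_mem_LieStr (a b : ℂ) : g4 a b ∈ LieStr 4 := by
  refine ⟨fun x => ?_, fun x y z => ?_⟩ <;> ext k <;> fin_cases k
  all_goals simp [g4_apply, mul_comm]
  all_goals ring

theorem sl2_mem_unimodular : sl2 ∈ unimodular 4 := by
  intro x
  simp [trace_eq_sum, Fin.sum_univ_four, sl2_apply]

theorem sl2_notMem_traceSolvable : sl2 ∉ traceSolvable 4 := by
  intro h
  have := h ![1, 0, 0, 0] ![0, 1, 0, 0] ![0, 0, 1, 0]
  simp [trace_eq_sum, Fin.sum_univ_four, sl2_apply, rmul] at this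

theorem R2_mem_traceSolvable : R2 ∈ traceSolvable 4 := by
  intro x y z
  simp [trace_eq_sum, Fin.sum_univ_four, R2_apply, rmul]

theorem g5_mem_traceSolvable (a : ℂ) : g5 a ∈ traceSolvable 4 := by
  intro x y z
  simp [trace_eq_sum, Fin.sum_univ_four, g5_apply, rmul]

theorem g4_mem_traceSolvable (a b : ℂ) : g4 a b ∈ traceSolvable 4 := by
  intro x y z
  simp [trace_eq_sum, Fin.sum_univ_four, g4_apply, rmul]

theorem R2_notMem_unimodular : R2 ∉ unimodular 4 := by
  intro h
  have := h ![1, 0, 0, 0]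
  simp [trace_eq_sum, Fin.sum_univ_four, R2_apply] at this

theorem g5_notMem_unimodular : g5 1 ∉ unimodular 4 := by
  intro h
  have := h ![1, 0, 0, 0]
  simp [trace_eq_sum, Fin.sum_univ_four, g5_apply] at this

theorem g4_notMem_unimodular : g4 1 1 ∉ unimodular 4 := by
  intro h
  have := h ![1, 0, 0, 0]
  simp [trace_eq_sum, Fin.sum_univ_four, g4_apply] at this
  norm_num at this

/-- Only `x 0` contributes to the eigenvalues of the left multiplication by `x`, so the trace is a
multiple of `x 0` and the trace form a multiple of `y 0 * z 0`. The same holds for `g4`; for `R2`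
the two coordinates `x 0` and `x 2` are independent. -/
theorem g5_mem_traceProportional (a : ℂ) : g5 a ∈ traceProportional 4 := by
  intro x y z
  simp [trace_eq_sum, Fin.sum_univ_four, g5_apply]
  ring

theorem g4_mem_traceProportional (a b : ℂ) : g4 a b ∈ traceProportional 4 := by
  intro x y z
  simp [trace_eq_sum, Fin.sum_univ_four, g4_apply]
  ring

theorem R2_notMem_traceProportional : R2 ∉ traceProportional 4 := by
  intro h
  have := h ![1, 0, 0, 0] ![0, 0, 1, 0] ![1, 0, 0, 0]
  simp [trace_eq_sum, Fin.sum_univ_four, R2_apply] at this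

theorem R2_mem_metabelian : R2 ∈ metabelian 4 := by
  intro x y z w
  ext k
  fin_cases k <;> simp [R2_apply]

theorem g4_mem_metabelian (a b : ℂ) : g4 a b ∈ metabelian 4 := by
  intro x y z w
  ext k
  fin_cases k <;> simp [g4_apply]

theorem g5_notMem_metabelian : g5 1 ∉ metabelian 4 := by
  intro h
  have := congrFun (h ![1, 0, 0, 0] ![0, 1, 0, 0] ![1, 0, 0, 0] ![0, 0, 1, 0]) 3
  simp [g5_apply] at this

/-- The expression is six times the third elementary symmetric function, and a left multiplication
of `R2` has eigenvalues `x 0, x 2, 0, 0`. -/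
theorem R2_mem_thirdSymmZero : R2 ∈ thirdSymmZero 4 := by
  intro x
  simp [trace_eq_sum, Fin.sum_univ_four, R2_apply]
  ring

theorem g4_notMem_thirdSymmZero : g4 1 1 ∉ thirdSymmZero 4 := by
  intro h
  have := h ![1, 0, 0, 0]
  simp [trace_eq_sum, Fin.sum_univ_four, g4_apply] at this
  norm_num at this

/-- For eigenvalues `λ₁, λ₂, λ₃, 0` with sum `s` the cubic equals `3 (s - 2λ₁)(s - 2λ₂)(s - 2λ₃)`.
Here the eigenvalues are `x 0` times `1, a, a + 1`, and the last is the sum of the other two. -/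
theorem g5_mem_eigenvalueSum (a : ℂ) : g5 a ∈ eigenvalueSum 4 := by
  intro x
  simp [trace_eq_sum, Fin.sum_univ_four, g5_apply]
  ring

theorem g4_notMem_eigenvalueSum : g4 1 1 ∉ eigenvalueSum 4 := by
  intro h
  have := h ![1, 0, 0, 0]
  simp [trace_eq_sum, Fin.sum_univ_four, g4_apply] at this
  norm_num at this

/-! ### Squares in Leibniz algebras -/

theorem LieStr.neg_swap {n : ℕ} {m : AlgStr n} (hm : m ∈ LieStr n) (x y : Fin n → ℂ) :
    m x y = -m y x := by
  have := hm.1 (x + y)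
  simp only [map_add, LinearMap.add_apply, hm.1, zero_add, add_zero] at this
  exact eq_neg_of_add_eq_zero_right this

theorem LieStr_subset_Leib (n : ℕ) : LieStr n ⊆ Leib n := by
  intro m hm x y z
  have h := hm.2 x y z
  have h₁ := LieStr.neg_swap hm (m y z) x
  have h₂ := LieStr.neg_swap hm z x
  rw [h₂, h₁, map_neg, LinearMap.neg_apply] at h
  linear_combination h

theorem mem_LieStr_of_sq {n : ℕ} {m : AlgStr n} (hm : m ∈ Leib n) (h : ∀ x, m x x = 0) :
    m ∈ LieStr n := by
  have anti : ∀ x y, m x y = -m y x := fun x y => by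
    have := h (x + y)
    simp only [map_add, LinearMap.add_apply, h, zero_add, add_zero] at this
    exact eq_neg_of_add_eq_zero_right this
  refine ⟨h, fun x y z => ?_⟩
  rw [hm x y z, anti x z, anti x (m y z), map_neg, LinearMap.neg_apply]
  abel

theorem Leib.mul_sq {n : ℕ} {m : AlgStr n} (hm : m ∈ Leib n) (x y : Fin n → ℂ) :
    m x (m y y) = 0 := by
  have := hm x y y
  simpa using this

/-- Row `r` of the matrix is a coordinate of the left multiplication by a basis vector. By
`Leib.mul_sq` every square lies in its kernel, so invertibility makes all squares vanish. -/
theorem mem_LieStr_of_det_ne_zero {n : ℕ} {m : AlgStr n} (hm : m ∈ Leib n) (i k : Fin n → Fin n)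
    (h : (Matrix.of fun r c => m (Pi.single (i r) 1) (Pi.single c 1) (k r)).det ≠ 0) :
    m ∈ LieStr n := by
  refine mem_LieStr_of_sq hm fun y => ?_
  refine Matrix.eq_zero_of_mulVec_eq_zero h (funext fun r => ?_)
  have := congrFun (Leib.mul_sq hm (Pi.single (i r) 1) y) (k r)
  generalize m y y = v at *
  rw [← Finset.univ_sum_single v] at this
  have hs : ∀ c : Fin n, (Pi.single c (v c) : Fin n → ℂ) = v c • Pi.single c (1 : ℂ) := by
    intro c
    rw [← Pi.single_smul]; simp
  simp only [hs, map_sum, map_smul, Finset.sum_apply, Pi.smul_apply, smul_eq_mul] at this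
  simpa [Matrix.mulVec, dotProduct, mul_comm] using this

theorem det_structConst_mem {n : ℕ} (i k : Fin n → Fin n) :
    (fun m : AlgStr n => (Matrix.of fun r c =>
      m (Pi.single (i r) 1) (Pi.single c 1) (k r)).det) ∈ regFun n :=
  det_mem _ fun _ _ => structConst_mem_regFun (_, _, _)

theorem rmul_mul {n : ℕ} {m : AlgStr n} (hm : m ∈ Leib n) (y z : Fin n → ℂ) :
    rmul m (m y z) = rmul m z * rmul m y - rmul m y * rmul m z := by
  refine LinearMap.ext fun a => ?_
  simp only [rmul, LinearMap.flip_apply, LinearMap.sub_apply, Module.End.mul_apply]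
  rw [hm a y z]
  abel

/-! ### The trace form, and Leibniz algebras that violate Cartan's criterion -/

/-- The trace form of the right multiplications. -/
noncomputable def traceForm {n : ℕ} (m : AlgStr n) (x y : Fin n → ℂ) : ℂ :=
  LinearMap.trace ℂ _ (rmul m x * rmul m y)

section traceForm

variable {n : ℕ} {m : AlgStr n}

theorem traceForm_comm (x y : Fin n → ℂ) : traceForm m x y = traceForm m y x :=
  LinearMap.trace_mul_comm _ _ _

theorem traceForm_add_left (x y z : Fin n → ℂ) :
    traceForm m (x + y) z = traceForm m x z + traceForm m y z := by
  simp [traceForm, rmul, add_mul]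

theorem traceForm_smul_left (c : ℂ) (x z : Fin n → ℂ) :
    traceForm m (c • x) z = c * traceForm m x z := by
  simp [traceForm, rmul]

theorem traceForm_mul (hm : m ∈ Leib n) (x y z : Fin n → ℂ) : traceForm m x (m y z) =
    LinearMap.trace ℂ _ (rmul m x * rmul m z * rmul m y) -
      LinearMap.trace ℂ _ (rmul m x * rmul m y * rmul m z) := by
  rw [traceForm, rmul_mul hm, mul_sub, map_sub, mul_assoc, mul_assoc]

/-- Together with the two vanishing lemmas below, this makes the products `yz, zx, xy` dual to `x,
y, z` up to the common factor `traceForm m x (m y z)`. -/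
theorem traceForm_cycle (hm : m ∈ Leib n) (x y z : Fin n → ℂ) :
    traceForm m y (m z x) = traceForm m x (m y z) := by
  rw [traceForm_mul hm, traceForm_mul hm,
    LinearMap.trace_mul_cycle ℂ (rmul m x) (rmul m z) (rmul m y),
    ← LinearMap.trace_mul_cycle ℂ (rmul m y) (rmul m z) (rmul m x)]

theorem traceForm_left_self (hm : m ∈ Leib n) (x y : Fin n → ℂ) :
    traceForm m x (m x y) = 0 := by
  rw [traceForm_mul hm, LinearMap.trace_mul_cycle ℂ (rmul m x) (rmul m y) (rmul m x), sub_self]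

theorem traceForm_right_self (hm : m ∈ Leib n) (x y : Fin n → ℂ) :
    traceForm m x (m y x) = 0 := by
  rw [traceForm_mul hm, LinearMap.trace_mul_cycle ℂ (rmul m x) (rmul m y) (rmul m x), sub_self]

end traceForm

/-- Dual triples are independent modulo the radical of the form, and `i` lies in the radical. So `p
0, p 1, p 2, i` is a basis, and its first three coordinates are read off by pairing with `q`. -/
theorem exists_eq_of_dual {m : AlgStr 4} {i : Fin 4 → ℂ} (hi : i ≠ 0) (hR : rmul m i = 0)
    {τ : ℂ} (hτ : τ ≠ 0) {p q : Fin 3 → Fin 4 → ℂ}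
    (h : ∀ j k, traceForm m (p j) (q k) = if j = k then τ else 0) (a : Fin 4 → ℂ) :
    ∃ c : ℂ, a = (traceForm m a (q 0) / τ) • p 0 + (traceForm m a (q 1) / τ) • p 1 +
      (traceForm m a (q 2) / τ) • p 2 + c • i := by
  have hi0 : ∀ b, traceForm m i b = 0 := fun b => by simp [traceForm, hR]
  have hli : LinearIndependent ℂ ![p 0, p 1, p 2, i] := by
    rw [Fintype.linearIndependent_iff]
    intro g hg
    simp only [Fin.sum_univ_four, Matrix.cons_val] at hg
    have key : ∀ k : Fin 3, (g 0 * if (0 : Fin 3) = k then τ else 0) +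
        (g 1 * if (1 : Fin 3) = k then τ else 0) + (g 2 * if (2 : Fin 3) = k then τ else 0) = 0 := by
      intro k
      have := congrArg (fun v => traceForm m v (q k)) hg
      simp only [traceForm_add_left, traceForm_smul_left, h, hi0] at this
      simpa [traceForm, rmul] using this
    have h0 : g 0 = 0 := by simpa [hτ] using key 0
    have h1 : g 1 = 0 := by simpa [hτ] using key 1
    have h2 : g 2 = 0 := by simpa [hτ] using key 2
    have h3 : g 3 = 0 := by simpa [h0, h1, h2, hi] using hg
    intro l
    fin_cases l <;> assumption
  let b := basisOfLinearIndependentOfCardEqFinrank hli (by simp)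
  have hb : ⇑b = ![p 0, p 1, p 2, i] := coe_basisOfLinearIndependentOfCardEqFinrank _ _
  have ha := b.sum_repr a
  simp only [Fin.sum_univ_four, hb, Matrix.cons_val] at ha
  have key : ∀ k : Fin 3, traceForm m a (q k) = (b.repr a 0 * if (0 : Fin 3) = k then τ else 0) +
      (b.repr a 1 * if (1 : Fin 3) = k then τ else 0) +
      (b.repr a 2 * if (2 : Fin 3) = k then τ else 0) := by
    intro k
    conv_lhs => rw [← ha]
    simp only [traceForm_add_left, traceForm_smul_left, h, hi0]
    ring
  refine ⟨b.repr a 3, ?_⟩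
  rw [key 0, key 1, key 2]
  simp only [Fin.isValue, if_true, if_false, mul_zero, add_zero, zero_add,
    show ((0 : Fin 3) = 1) = False by simp, show ((0 : Fin 3) = 2) = False by simp,
    show ((1 : Fin 3) = 0) = False by simp, show ((1 : Fin 3) = 2) = False by simp,
    show ((2 : Fin 3) = 0) = False by simp, show ((2 : Fin 3) = 1) = False by simp,
    mul_div_cancel_right₀ _ hτ]
  exact ha.symm

/-- A four dimensional Leibniz algebra violating Cartan's trace criterion is a Lie algebra. -/
theorem mem_LieStr_of_traceForm_ne_zero {m : AlgStr 4} (hm : m ∈ Leib 4) {x y z : Fin 4 → ℂ}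
    (hT : traceForm m x (m y z) ≠ 0) : m ∈ LieStr 4 := by
  by_contra hcon
  obtain ⟨u, hu⟩ : ∃ u, m u u ≠ 0 := by
    by_contra! h
    exact hcon (mem_LieStr_of_sq hm h)
  obtain ⟨i, rfl⟩ : ∃ i, i = m u u := ⟨_, rfl⟩
  set i := m u u with hidef
  have hRi : rmul m i = 0 := LinearMap.ext fun a => Leib.mul_sq hm a u
  have hmi : ∀ a, m a i = 0 := fun a => Leib.mul_sq hm a u
  set τ := traceForm m x (m y z) with hτ
  have h₁ : ∀ j k, traceForm m (![x, y, z] j) (![m y z, m z x, m x y] k) =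
      if j = k then τ else 0 := by
    intro j k
    fin_cases j <;> fin_cases k <;>
      simp [traceForm_left_self hm, traceForm_right_self hm, hτ, traceForm_cycle hm]
  have h₂ : ∀ j k, traceForm m (![m y z, m z x, m x y] j) (![x, y, z] k) =
      if j = k then τ else 0 := by
    intro j k
    rw [traceForm_comm, h₁]
    simp [eq_comm]
  have e₁ := exists_eq_of_dual hu hRi hT h₁
  have e₂ := exists_eq_of_dual hu hRi hT h₂
  simp only [Matrix.cons_val] at e₁ e₂
  -- An element with zero right multiplication pairs to zero with everything, so only its
  -- `i`-coordinate survives.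
  have hann : ∀ a, rmul m a = 0 → ∃ c : ℂ, a = c • i := by
    intro a ha
    obtain ⟨c, hc⟩ := e₁ a
    exact ⟨c, by simpa [traceForm, ha] using hc⟩
  have hχ : ∀ a, ∃ c : ℂ, m i a = c • i := fun a => hann _ (by rw [rmul_mul hm, hRi]; simp)
  -- Right multiplications act on the line of `i` by scalars, which commute, and `i(ab) = (ia)b -
  -- (ib)a`. As the products `yz, zx, xy` together with `i` span, `i` annihilates everything from
  -- the left as well.
  have hiw : ∀ a b, m i (m a b) = 0 := by
    intro a b
    obtain ⟨c, hc⟩ := hχ a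
    obtain ⟨d, hd⟩ := hχ b
    have := hm i a b
    simp only [hc, hd, map_smul, LinearMap.smul_apply] at this
    rw [smul_comm] at this
    simpa using this
  have him : ∀ a, m i a = 0 := by
    intro a
    obtain ⟨c, hc⟩ := e₂ a
    rw [hc]
    simp [hiw, hmi]
  have hS : ∀ a b, ∃ c : ℂ, m a b + m b a = c • i := by
    refine fun a b => hann _ ?_
    have : rmul m (m a b + m b a) = rmul m (m a b) + rmul m (m b a) := by simp [rmul]
    rw [this, rmul_mul hm, rmul_mul hm]
    abel
  have hSl : ∀ a b c, m c (m a b) = -m c (m b a) := by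
    intro a b c
    obtain ⟨d, hd⟩ := hS a b
    have := hmi c
    rw [← add_eq_zero_iff_eq_neg, ← map_add, hd, map_smul, hmi, smul_zero]
  have hSr : ∀ a b c, m (m a b) c = -m (m b a) c := by
    intro a b c
    obtain ⟨d, hd⟩ := hS a b
    rw [← add_eq_zero_iff_eq_neg, ← LinearMap.add_apply, ← map_add, hd, map_smul,
      LinearMap.smul_apply, him, smul_zero]
  -- The symmetrized product takes values in the line of `i` and inherits the invariance `S(a, bc) =
  -- -S(b, ac)`. The aim is `S = 0`, which contradicts `uu ≠ 0`.
  let S : (Fin 4 → ℂ) → (Fin 4 → ℂ) → (Fin 4 → ℂ) := fun a b => m a b + m b a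
  have hScomm : ∀ a b, S a b = S b a := fun a b => add_comm _ _
  have hSneg : ∀ a b c, S a (m b c) = -S a (m c b) := by
    intro a b c
    simp only [S]
    rw [hSl b c a, hSr b c a]
    abel
  have hinv : ∀ a b c, S a (m b c) = -S b (m a c) := by
    intro a b c
    obtain ⟨d, hd⟩ := hS a b
    have h1 := hm a b c
    have h2 := hm b a c
    have h3 : m (m a b) c + m (m b a) c = 0 := by
      rw [← LinearMap.add_apply, ← map_add, hd, map_smul, LinearMap.smul_apply, him, smul_zero]
    rw [h1, h2] at h3
    simp only [S]
    linear_combination h3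
  have hSadd : ∀ a b c, S a (b + c) = S a b + S a c := fun a b c => by
    simp only [S, map_add, LinearMap.add_apply]; abel
  have hSsmul : ∀ a b (c : ℂ), S a (c • b) = c • S a b := fun a b c => by
    simp only [S, map_smul, LinearMap.smul_apply, smul_add]
  have hSi : ∀ a, S a i = 0 := fun a => by simp [S, hmi, him]
  have t₁ : S y (m z x) = S x (m y z) := by
    rw [hSneg y z x, hinv y x z, neg_neg]
  have t₂ : S z (m x y) = S x (m y z) := by
    rw [hinv z x y, hSneg x z y, neg_neg]
  have z₁ : ∀ a b, S a (m a b) = 0 := fun a b => self_eq_neg.1 (hinv a a b)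
  have z₂ : ∀ a b, S a (m b a) = 0 := fun a b => by rw [hSneg, z₁, neg_zero]
  have hcyc : m (m x y) z + m (m z x) y + m (m y z) x = S x (m y z) := by
    have h1 := hm x y z
    rw [hSr x z y] at h1
    simp only [S]
    linear_combination h1
  obtain ⟨c₀, E₀⟩ := e₁ (m y z)
  obtain ⟨c₁, E₁⟩ := e₁ (m z x)
  obtain ⟨c₂, E₂⟩ := e₁ (m x y)
  rw [traceForm_comm (m z x) (m y z)] at E₁
  rw [traceForm_comm (m x y) (m y z), traceForm_comm (m x y) (m z x)] at E₂
  have ht : S x (m y z) = 0 := by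
    have f₀ := congrArg (S x) E₀
    have f₁ := congrArg (S y) E₁
    have f₂ := congrArg (S z) E₂
    have k₀ := congrArg (fun v => m v x) E₀
    have k₁ := congrArg (fun v => m v y) E₁
    have k₂ := congrArg (fun v => m v z) E₂
    rw [t₁] at f₁
    rw [t₂] at f₂
    generalize traceForm m (m y z) (m y z) / τ = M₀₀ at *
    generalize traceForm m (m y z) (m z x) / τ = M₀₁ at *
    generalize traceForm m (m y z) (m x y) / τ = M₀₂ at *
    generalize traceForm m (m z x) (m z x) / τ = M₁₁ at *
    generalize traceForm m (m z x) (m x y) / τ = M₁₂ at *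
    generalize traceForm m (m x y) (m x y) / τ = M₂₂ at *
    simp only [hSadd, hSsmul, hSi, smul_zero, add_zero, map_add, map_smul, LinearMap.add_apply,
      LinearMap.smul_apply, him] at f₀ f₁ f₂ k₀ k₁ k₂
    rw [k₀, k₁, k₂] at hcyc
    -- The matrix `M` of `yz, zx, xy` in terms of `x, y, z` is symmetric, being a matrix of form
    -- values. Adding `S(x, yz)`, `S(y, zx)`, `S(z, xy)`, all equal, gives `3 S(x, yz) = ∑ M_jk
    -- S(p_j, p_k)`. By symmetry this is twice `∑ M_jk p_k p_j`, which is the cyclic sum in `hcyc`,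
    -- namely `S(x, yz)`.
    have : (3 : ℂ) • S x (m y z) = (2 : ℂ) • S x (m y z) := by
      calc _ = S x (m y z) + S x (m y z) + S x (m y z) := by module
        _ = (2 : ℂ) • (M₀₂ • m x z + M₁₂ • m y z + M₂₂ • m z z +
          (M₀₁ • m x y + M₁₁ • m y y + M₁₂ • m z y) +
          (M₀₀ • m x x + M₀₁ • m y x + M₀₂ • m z x)) := by
            conv_lhs => 
              congr
              · congr
                · rw [f₀]
                · rw [f₁]
              · rw [f₂]
            simp only [S]
            module
        _ = _ := by rw [hcyc]
    rw [← sub_eq_zero, ← sub_smul] at this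
    norm_num at this
    exact this
  have hzero : ∀ a b, S a b = 0 := by
    have hw : ∀ a, S a (m y z) = 0 ∧ S a (m z x) = 0 ∧ S a (m x y) = 0 := by
      intro a
      obtain ⟨c, hc⟩ := e₁ a
      rw [hScomm a, hScomm a, hScomm a, hc]
      simp only [hSadd, hSsmul, hSi]
      rw [hScomm _ x, hScomm _ y, hScomm _ z, hScomm _ x, hScomm _ y, hScomm _ z, hScomm _ x,
        hScomm _ y, hScomm _ z, t₁, t₂, ht]
      simp [z₁, z₂]
    intro a b
    obtain ⟨c, hc⟩ := e₂ b
    rw [hc]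
    simp [hSadd, hSsmul, hSi, hw]
  have := hzero u u
  simp only [S, ← two_smul ℂ] at this
  simp [hu, i] at this

/-! ### Recognizing a Lie algebra from a basis -/

theorem LieStr.mul_mul {n : ℕ} {m : AlgStr n} (hm : m ∈ LieStr n) (x y z : Fin n → ℂ) :
    m x (m y z) = m (m x y) z + m y (m x z) := by
  have h := LieStr_subset_Leib n hm x y z
  rw [LieStr.neg_swap hm (m x z) y] at h
  linear_combination -h

/-- Every vector is a linear combination of the four given ones. -/
def Spans (u₀ u₁ u₂ u₃ : Fin 4 → ℂ) : Prop :=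
  ∀ v, ∃ a b c d : ℂ, v = a • u₀ + b • u₁ + c • u₂ + d • u₃

theorem Spans.trans {u₀ u₁ u₂ u₃ w₀ w₁ w₂ w₃ : Fin 4 → ℂ} (h : Spans u₀ u₁ u₂ u₃)
    (h₀ : ∃ a b c d : ℂ, u₀ = a • w₀ + b • w₁ + c • w₂ + d • w₃)
    (h₁ : ∃ a b c d : ℂ, u₁ = a • w₀ + b • w₁ + c • w₂ + d • w₃)
    (h₂ : ∃ a b c d : ℂ, u₂ = a • w₀ + b • w₁ + c • w₂ + d • w₃)
    (h₃ : ∃ a b c d : ℂ, u₃ = a • w₀ + b • w₁ + c • w₂ + d • w₃) : Spans w₀ w₁ w₂ w₃ := by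
  intro v
  obtain ⟨a, b, c, d, rfl⟩ := h v
  obtain ⟨a₀, b₀, c₀, d₀, rfl⟩ := h₀
  obtain ⟨a₁, b₁, c₁, d₁, rfl⟩ := h₁
  obtain ⟨a₂, b₂, c₂, d₂, rfl⟩ := h₂
  obtain ⟨a₃, b₃, c₃, d₃, rfl⟩ := h₃
  exact ⟨a * a₀ + b * a₁ + c * a₂ + d * a₃, a * b₀ + b * b₁ + c * b₂ + d * b₃,
    a * c₀ + b * c₁ + c * c₂ + d * c₃, a * d₀ + b * d₁ + c * d₂ + d * d₃, by module⟩

theorem Spans.exists_basis {u₀ u₁ u₂ u₃ : Fin 4 → ℂ} (h : Spans u₀ u₁ u₂ u₃) :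
    ∃ b : Module.Basis (Fin 4) ℂ (Fin 4 → ℂ), ⇑b = ![u₀, u₁, u₂, u₃] := by
  refine ⟨basisOfTopLeSpanOfCardEqFinrank ![u₀, u₁, u₂, u₃] ?_ (by simp),
    coe_basisOfTopLeSpanOfCardEqFinrank _ _ _⟩
  intro v _
  obtain ⟨a, b, c, d, rfl⟩ := h v
  have hmem : ∀ i, ![u₀, u₁, u₂, u₃] i ∈ Submodule.span ℂ (Set.range ![u₀, u₁, u₂, u₃]) :=
    fun i => Submodule.subset_span ⟨i, rfl⟩
  exact add_mem (add_mem (add_mem (Submodule.smul_mem _ _ (hmem 0)) (Submodule.smul_mem _ _ (hmem 1)))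
    (Submodule.smul_mem _ _ (hmem 2))) (Submodule.smul_mem _ _ (hmem 3))

theorem Spans.of_linearIndependent {u₀ u₁ u₂ u₃ : Fin 4 → ℂ}
    (h : LinearIndependent ℂ ![u₀, u₁, u₂, u₃]) : Spans u₀ u₁ u₂ u₃ := by
  intro v
  let b := basisOfLinearIndependentOfCardEqFinrank h (by simp)
  have hv := b.sum_repr v
  simp only [b, Fin.sum_univ_four, coe_basisOfLinearIndependentOfCardEqFinrank,
    Matrix.cons_val] at hv
  exact ⟨_, _, _, _, hv.symm⟩

theorem anticomm_single (b12 b13 b14 b23 b24 b34 : Fin 4 → ℂ) (i j : Fin 4) :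
    anticomm b12 b13 b14 b23 b24 b34 (Pi.single i 1) (Pi.single j 1) =
      ![![0, b12, b13, b14], ![-b12, 0, b23, b24], ![-b13, -b23, 0, b34],
        ![-b14, -b24, -b34, 0]] i j := by
  rw [anticomm_apply]
  fin_cases i <;> fin_cases j <;> simp

/-- A Lie algebra structure belongs to the orbit of `anticomm b12 …` as soon as some basis has the
corresponding multiplication table. -/
theorem mem_orbit_anticomm {m : AlgStr 4} (hm : m ∈ LieStr 4) {u₀ u₁ u₂ u₃ : Fin 4 → ℂ}
    (hu : Spans u₀ u₁ u₂ u₃) {b12 b13 b14 b23 b24 b34 : Fin 4 → ℂ}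
    (h12 : m u₀ u₁ = b12 0 • u₀ + b12 1 • u₁ + b12 2 • u₂ + b12 3 • u₃)
    (h13 : m u₀ u₂ = b13 0 • u₀ + b13 1 • u₁ + b13 2 • u₂ + b13 3 • u₃)
    (h14 : m u₀ u₃ = b14 0 • u₀ + b14 1 • u₁ + b14 2 • u₂ + b14 3 • u₃)
    (h23 : m u₁ u₂ = b23 0 • u₀ + b23 1 • u₁ + b23 2 • u₂ + b23 3 • u₃)
    (h24 : m u₁ u₃ = b24 0 • u₀ + b24 1 • u₁ + b24 2 • u₂ + b24 3 • u₃)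
    (h34 : m u₂ u₃ = b34 0 • u₀ + b34 1 • u₁ + b34 2 • u₂ + b34 3 • u₃) :
    m ∈ orbit (anticomm b12 b13 b14 b23 b24 b34) := by
  obtain ⟨b, hb⟩ := hu.exists_basis
  have hg : ∀ v : Fin 4 → ℂ, b.equivFun.symm v = v 0 • u₀ + v 1 • u₁ + v 2 • u₂ + v 3 • u₃ := by
    intro v
    simp [Module.Basis.equivFun_symm_apply, Fin.sum_univ_four, hb]
  refine ⟨b.equivFun.symm, ?_⟩
  have key : m = ((anticomm b12 b13 b14 b23 b24 b34).compl₁₂ b.equivFun.toLinearMap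
      b.equivFun.toLinearMap).compr₂ b.equivFun.symm.toLinearMap := by
    refine b.ext fun i => b.ext fun j => ?_
    simp only [LinearMap.compr₂_apply, LinearMap.compl₁₂_apply, LinearEquiv.coe_coe]
    have he : ∀ i, b.equivFun (b i) = Pi.single i 1 := fun i => by
      ext j
      simp [Pi.single_apply, eq_comm]
    rw [he, he, anticomm_single, hg, hb]
    fin_cases i <;> fin_cases j <;>
      simp [hm.1, h12, h13, h14, h23, h24, h34, LieStr.neg_swap hm u₁ u₀, LieStr.neg_swap hm u₂ u₀,
        LieStr.neg_swap hm u₃ u₀, LieStr.neg_swap hm u₂ u₁, LieStr.neg_swap hm u₃ u₁,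
        LieStr.neg_swap hm u₃ u₂] <;> module
  intro x y
  conv_lhs => rw [key]
  rfl

theorem polyCurve_anticomm {b12 b13 b14 b23 b24 b34 : ℂ → Fin 4 → ℂ}
    (h12 : ∀ k, (fun s => b12 s k) ∈ polyFun) (h13 : ∀ k, (fun s => b13 s k) ∈ polyFun)
    (h14 : ∀ k, (fun s => b14 s k) ∈ polyFun) (h23 : ∀ k, (fun s => b23 s k) ∈ polyFun)
    (h24 : ∀ k, (fun s => b24 s k) ∈ polyFun) (h34 : ∀ k, (fun s => b34 s k) ∈ polyFun) :
    PolyCurve fun s => anticomm (b12 s) (b13 s) (b14 s) (b23 s) (b24 s) (b34 s) := by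
  rintro ⟨i, j, k⟩
  simp only [structConst, anticomm_single]
  have h0 : (fun _ : ℂ => (0 : ℂ)) ∈ polyFun := const_mem _ _
  fin_cases i <;> fin_cases j <;> simp only [Fin.zero_eta, Fin.isValue, Fin.mk_one, 
    Fin.reduceFinMk, Matrix.cons_val, Pi.zero_apply, Pi.neg_apply] <;>
    first | exact h0 | exact h12 k | exact h13 k | exact h14 k | exact h23 k | exact h24 k |
      exact h34 k | exact neg_mem (h12 k) | exact neg_mem (h13 k) | exact neg_mem (h14 k) |
      exact neg_mem (h23 k) | exact neg_mem (h24 k) | exact neg_mem (h34 k)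

/-- Transport to an orbit keeps a structure in the closure of a union of orbits, if it is on a
generically good curve. -/
theorem mem_closure_of_orbit_curve {S : Set (AlgStr 4)} (hS : ∀ m ∈ S, orbit m ⊆ S)
    {c : ℂ → AlgStr 4} (hc : PolyCurve c) {B : Set ℂ} (hB : B.Finite) (h : ∀ t ∉ B, c t ∈ S)
    {m : AlgStr 4} (hm : m ∈ orbit (c 0)) : m ∈ closure S := by
  obtain ⟨G, hG, rfl⟩ := exists_adjConj hm
  exact mem_closure_of_curve (polyCurve_adjConj hc fun i j => const_mem _ (G i j)) hB
    (fun t ht => subset_closure (hS _ (h t ht) (adjConj_mem_orbit hG _))) 0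

/-! ### Abelian ideals of codimension one -/

/-- `e_1` acts on the abelian ideal spanned by `e_2, e_3, e_4` by the matrix `M`. -/
def abelianExt (M : Matrix (Fin 3) (Fin 3) ℂ) : AlgStr 4 :=
  anticomm ![0, M 0 0, M 1 0, M 2 0] ![0, M 0 1, M 1 1, M 2 1] ![0, M 0 2, M 1 2, M 2 2] 0 0 0

theorem abelianExt_apply (M : Matrix (Fin 3) (Fin 3) ℂ) (x y : Fin 4 → ℂ) :
    abelianExt M x y = x 0 • Matrix.vecCons 0 (M.mulVec ![y 1, y 2, y 3]) -
      y 0 • Matrix.vecCons 0 (M.mulVec ![x 1, x 2, x 3]) := by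
  rw [abelianExt, anticomm_apply]
  ext k
  fin_cases k <;> simp [Matrix.mulVec, dotProduct, Fin.sum_univ_three] <;> ring

theorem abelianExt_mem_LieStr (M : Matrix (Fin 3) (Fin 3) ℂ) : abelianExt M ∈ LieStr 4 := by
  refine ⟨fun x => by simp [abelianExt_apply], fun x y z => ?_⟩
  rw [abelianExt, anticomm_apply, anticomm_apply, anticomm_apply]
  ext k
  fin_cases k <;> simp [anticomm_apply] <;> ring

/-- The matrix with columns `v, M v, M² v` for `v = (1, 1, 1)`. -/
def krylov (M : Matrix (Fin 3) (Fin 3) ℂ) : Matrix (Fin 3) (Fin 3) ℂ :=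
  Matrix.of fun i j => ![fun _ => 1, M.mulVec fun _ => 1, M.mulVec (M.mulVec fun _ => 1)] j i

theorem exists_roots_charpoly (M : Matrix (Fin 3) (Fin 3) ℂ) : ∃ p q r : ℂ, p * q * r = M.det ∧
    ∀ v, M.mulVec (M.mulVec (M.mulVec v)) - (p + q + r) • M.mulVec (M.mulVec v) +
      (p * q + p * r + q * r) • M.mulVec v - (p * q * r) • v = 0 := by
  have hs := IsAlgClosed.splits M.charpoly
  have hc : M.charpoly.roots.card = 3 := by
    rw [← hs.natDegree_eq_card_roots, Matrix.charpoly_natDegree_eq_dim, Fintype.card_fin]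
  obtain ⟨p, q, r, h⟩ := Multiset.card_eq_three.1 hc
  have hM : M.charpoly =
      (Polynomial.X - Polynomial.C p) * (Polynomial.X - Polynomial.C q) *
      (Polynomial.X - Polynomial.C r) := by
    have := hs.eq_prod_roots_of_monic M.charpoly_monic
    rw [h] at this
    simpa [mul_assoc] using this
  refine ⟨p, q, r, ?_, fun v => ?_⟩
  · rw [Matrix.det_eq_sign_charpoly_coeff, hM]
    simp [Polynomial.coeff_zero_eq_eval_zero]
    ring
  · have := M.aeval_self_charpoly
    rw [hM] at this
    have := congrArg (fun A => A.mulVec v) this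
    simp only [map_mul, map_sub, Polynomial.aeval_X, Polynomial.aeval_C, ← Matrix.mulVec_mulVec,
      Matrix.sub_mulVec, Matrix.mulVec_sub, Algebra.algebraMap_eq_smul_one, Matrix.smul_mulVec,
      Matrix.one_mulVec, Matrix.mulVec_smul, Matrix.zero_mulVec] at this
    rw [← this]
    module

/-- With eigenvalues `p, q, r` and the cyclic vector `v = (1, 1, 1)`, the vectors `(M - q)(M - r)v`,
`(M - r)v`, `v` bring `M` to the bidiagonal form of `g4`. Dividing `e_1` by `p` makes the first
eigenvalue `1`, which is where invertibility enters; the powers of `p` normalize the off-diagonal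
entries. -/
theorem abelianExt_mem_orbit {M : Matrix (Fin 3) (Fin 3) ℂ} (hdet : M.det ≠ 0)
    (hcyc : (krylov M).det ≠ 0) : ∃ a b, abelianExt M ∈ orbit (g4 a b) := by
  obtain ⟨p, q, r, hpqr, hCH⟩ := exists_roots_charpoly M
  have hp : p ≠ 0 := by
    rintro rfl
    exact hdet (by rw [← hpqr]; ring)
  have hCH := hCH fun _ => 1
  set v : Fin 3 → ℂ := fun _ => 1 with hv
  set w := M.mulVec v with hw
  let emb : (Fin 3 → ℂ) →ₗ[ℂ] (Fin 4 → ℂ) :=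
    { toFun := fun v => Matrix.vecCons 0 v
      map_add' := fun x y => by simp
      map_smul' := fun a x => by simp }
  have hemb : ∀ v, emb v = Matrix.vecCons 0 v := fun _ => rfl
  set e : Fin 4 → ℂ := Pi.single 0 1 with he
  have hact : ∀ v, abelianExt M e (emb v) = emb (M.mulVec v) := fun v => by
    rw [abelianExt_apply]
    simp only [he, hemb]
    have : ![v 0, v 1, v 2] = v := by ext i; fin_cases i <;> rfl
    simp [this]
  have hact' : ∀ v, abelianExt M (p⁻¹ • e) (emb v) = emb (p⁻¹ • M.mulVec v) := fun v => by
    rw [map_smul, LinearMap.smul_apply, hact, map_smul]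
  have habel : ∀ v v', abelianExt M (emb v) (emb v') = 0 := fun v v' => by
    rw [abelianExt_apply]
    simp [hemb]
  have hspan : Spans e (emb (M.mulVec w)) (emb w) (emb v) := by
    intro x
    obtain ⟨y, hy⟩ : ∃ y, (krylov M).mulVec y = ![x 1, x 2, x 3] :=
      ⟨(krylov M)⁻¹.mulVec ![x 1, x 2, x 3], by
        rw [Matrix.mulVec_mulVec, Matrix.mul_nonsing_inv _ (isUnit_iff_ne_zero.2 hcyc),
          Matrix.one_mulVec]⟩
    have hy' : y 2 • M.mulVec w + y 1 • w + y 0 • v = ![x 1, x 2, x 3] := by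
      rw [← hy]
      ext i
      change _ = ∑ j, krylov M i j * y j
      rw [Fin.sum_univ_three]
      change y 2 * _ + y 1 * _ + y 0 * _ = v i * y 0 + w i * y 1 + M.mulVec w i * y 2
      ring
    refine ⟨x 0, y 2, y 1, y 0, ?_⟩
    rw [add_assoc, add_assoc, ← map_smul, ← map_smul, ← map_smul, ← map_add, ← map_add,
      ← add_assoc, hy', hemb]
    ext k
    fin_cases k <;> simp [he]
  refine ⟨q / p, r / p, mem_orbit_anticomm (abelianExt_mem_LieStr M) (u₀ := p⁻¹ • e)
    (u₁ := emb ((p ^ 2)⁻¹ • (M.mulVec w - (q + r) • w + (q * r) • v)))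
    (u₂ := emb (p⁻¹ • (w - r • v))) (u₃ := emb v) ?_ ?_ ?_ ?_ ?_ ?_ ?_⟩
  · refine hspan.trans ⟨p, 0, 0, 0, ?_⟩ ⟨0, p ^ 2, p * (q + r), r ^ 2 + q * r - q * r, ?_⟩ 
      ⟨0, 0, p, r, ?_⟩ ⟨0, 0, 0, 1, by simp⟩
    · simp [hp]
    · simp only [map_smul, map_sub, map_add]
      match_scalars <;> field_simp <;> ring
    · simp only [map_smul, map_sub, map_add]
      match_scalars <;> field_simp <;> ring
  · simp only [hact', Matrix.cons_val, zero_smul, zero_add, add_zero, one_smul, ← map_smul emb,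
      ← map_add emb]
    refine congrArg emb ?_
    simp only [Matrix.mulVec_smul, Matrix.mulVec_sub, Matrix.mulVec_add, ← hw]
    have h : M.mulVec (M.mulVec w) = (p + q + r) • M.mulVec w - (p * q + p * r + q * r) • w +
        (p * q * r) • v := by linear_combination hCH
    rw [h]
    match_scalars <;> field_simp <;> ring
  · simp only [hact', Matrix.cons_val, zero_smul, zero_add, add_zero, one_smul, ← map_smul emb,
      ← map_add emb]
    refine congrArg emb ?_
    simp only [Matrix.mulVec_smul, Matrix.mulVec_sub, ← hw]
    match_scalars <;> field_simp <;> ring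
  · simp only [hact', Matrix.cons_val, zero_smul, zero_add, one_smul, ← map_smul emb,
      ← map_add emb]
    refine congrArg emb ?_
    simp only [← hw]
    match_scalars <;> field_simp
    ring
  · simp [habel]
  · simp [habel]
  · simp [habel]
theorem krylov_mem {G : ℂ → Matrix (Fin 3) (Fin 3) ℂ} (hG : ∀ i j, (fun s => G s i j) ∈ polyFun) :
    (fun s => (krylov (G s)).det) ∈ polyFun := by
  have h0 : ∀ i : Fin 3, (fun _ : ℂ => (fun _ => 1 : Fin 3 → ℂ) i) ∈ polyFun :=
    fun i => const_mem _ _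
  refine det_mem _ fun i j => ?_
  fin_cases j
  · exact h0 i
  · exact mulVec_mem _ hG h0 i
  · exact mulVec_mem _ hG (mulVec_mem _ hG h0) i

theorem orbit_subset_iUnion_g4 : ∀ m ∈ ⋃ a : ℂ, ⋃ b : ℂ, orbit (g4 a b),
    orbit m ⊆ ⋃ a : ℂ, ⋃ b : ℂ, orbit (g4 a b) := by
  intro m hm m' hm'
  simp only [Set.mem_iUnion] at hm ⊢
  obtain ⟨a, b, h⟩ := hm
  exact ⟨a, b, mem_orbit_trans hm' h⟩

/-- A Lie algebra with an abelian ideal of codimension one is in the closure of the family `g4`. -/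
theorem mem_closure_g4 {m : AlgStr 4} (hm : m ∈ LieStr 4) {x u₁ u₂ u₃ : Fin 4 → ℂ}
    (hs : Spans x u₁ u₂ u₃) (h12 : m u₁ u₂ = 0) (h13 : m u₁ u₃ = 0) (h23 : m u₂ u₃ = 0)
    (h₁ : ∃ a b c : ℂ, m x u₁ = a • u₁ + b • u₂ + c • u₃)
    (h₂ : ∃ a b c : ℂ, m x u₂ = a • u₁ + b • u₂ + c • u₃)
    (h₃ : ∃ a b c : ℂ, m x u₃ = a • u₁ + b • u₂ + c • u₃) :
    m ∈ closure (⋃ a : ℂ, ⋃ b : ℂ, orbit (g4 a b)) := by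
  obtain ⟨a₁, b₁, c₁, h₁⟩ := h₁
  obtain ⟨a₂, b₂, c₂, h₂⟩ := h₂
  obtain ⟨a₃, b₃, c₃, h₃⟩ := h₃
  let M : Matrix (Fin 3) (Fin 3) ℂ := !![a₁, a₂, a₃; b₁, b₂, b₃; c₁, c₂, c₃]
  -- Any invertible matrix with cyclic vector `(1, 1, 1)` would serve; for distinct diagonal entries
  -- `krylov N` is a Vandermonde matrix.
  let N : Matrix (Fin 3) (Fin 3) ℂ := Matrix.diagonal ![1, 2, 3]
  let G : ℂ → Matrix (Fin 3) (Fin 3) ℂ := fun s => M + s • (N - M)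
  have hG : ∀ i j, (fun s => G s i j) ∈ polyFun := fun i j =>
    add_mem (const_mem polyFun (M i j)) (mul_mem id_mem_polyFun (const_mem polyFun _))
  have hG1 : G 1 = N := by simp [G]
  have hG0 : G 0 = M := by simp [G]
  have hcurve : PolyCurve fun s => abelianExt (G s) := by
    have h0 : ∀ k, (fun _ : ℂ => (0 : Fin 4 → ℂ) k) ∈ polyFun := fun k => const_mem _ _
    refine polyCurve_anticomm ?_ ?_ ?_ h0 h0 h0 <;> intro k <;> fin_cases k <;>
      first | exact h0 0 | exact hG _ _
  refine mem_closure_of_orbit_curve orbit_subset_iUnion_g4 hcurve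
    (B := {t | (G t).det = 0} ∪ {t | (krylov (G t)).det = 0}) ?_ ?_ ?_
  · refine (finite_zeros_of_mem_polyFun (det_mem _ hG) (t₀ := 1) ?_).union
      (finite_zeros_of_mem_polyFun (krylov_mem hG) (t₀ := 1) ?_)
    · rw [hG1]
      simp [N, Matrix.det_diagonal, Fin.prod_univ_three]
    · rw [hG1]
      simp [N, krylov, Matrix.det_fin_three, Matrix.mulVec_diagonal]
      norm_num
  · intro t ht
    simp only [Set.mem_union, Set.mem_ofPred_eq, not_or] at ht
    obtain ⟨a, b, h⟩ := abelianExt_mem_orbit ht.1 ht.2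
    simp only [Set.mem_iUnion]
    exact ⟨a, b, h⟩
  · simp only [hG0]
    refine mem_orbit_anticomm hm hs ?_ ?_ ?_ ?_ ?_ ?_ <;> simp [M, h₁, h₂, h₃, h12, h13, h23]

/-! ### Heisenberg ideals of codimension one -/

/-- `e_1` acts on the Heisenberg algebra `[e_2, e_3] = e_4` by the derivation that extends a
linear map of the span of `e_2, e_3`. -/
def heisenbergExt (a b c d : ℂ) : AlgStr 4 :=
  anticomm ![0, a, c, 0] ![0, b, d, 0] ![0, 0, 0, a + d] ![0, 0, 0, 1] 0 0

theorem heisenbergExt_apply (a b c d : ℂ) (x y : Fin 4 → ℂ) : heisenbergExt a b c d x y =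
    ![0, a * (x 0 * y 1 - x 1 * y 0) + b * (x 0 * y 2 - x 2 * y 0),
      c * (x 0 * y 1 - x 1 * y 0) + d * (x 0 * y 2 - x 2 * y 0),
      (a + d) * (x 0 * y 3 - x 3 * y 0) + (x 1 * y 2 - x 2 * y 1)] := by
  rw [heisenbergExt, anticomm_apply]
  ext k
  fin_cases k <;> simp <;> ring

theorem heisenbergExt_mem_LieStr (a b c d : ℂ) : heisenbergExt a b c d ∈ LieStr 4 := by
  refine ⟨fun x => ?_, fun x y z => ?_⟩ <;> ext k <;> fin_cases k
  all_goals simp [heisenbergExt_apply, mul_comm]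
  all_goals ring

/-- Let `M` be the 2×2 action, with eigenvalues `p, q`. The condition `hcyc` says that `(1, 1)` is
cyclic. Then `(M - q)(1, 1) / p` is an eigenvector for `p`, and with `(1, 1)` and their bracket it
gives the table of `g5 (q / p)` once `e_1` is divided by `p`. -/
theorem heisenbergExt_mem_orbit {a b c d : ℂ} (hdet : a * d - b * c ≠ 0)
    (hcyc : c + d - a - b ≠ 0) : ∃ r, heisenbergExt a b c d ∈ orbit (g5 r) := by
  obtain ⟨p, hp⟩ := IsAlgClosed.exists_root
    (Polynomial.X ^ 2 - Polynomial.C (a + d) * Polynomial.X + Polynomial.C (a * d - b * c)) (by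
      have : (Polynomial.X ^ 2 - Polynomial.C (a + d) * Polynomial.X +
        Polynomial.C (a * d - b * c)).degree = 2 := by compute_degree!
      rw [this]
      norm_num)
  simp only [Polynomial.IsRoot, Polynomial.eval_add, Polynomial.eval_sub, Polynomial.eval_pow,
    Polynomial.eval_X, Polynomial.eval_mul, Polynomial.eval_C] at hp
  have hp0 : p ≠ 0 := by
    rintro rfl
    exact hdet (by simpa using hp)
  obtain ⟨q, hq⟩ : ∃ q, q = a + d - p := ⟨_, rfl⟩
  have hk : (a + b - c - d) ≠ 0 := fun h => hcyc (by linear_combination -h)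
  refine ⟨q / p, mem_orbit_anticomm (heisenbergExt_mem_LieStr a b c d) (u₀ := ![p⁻¹, 0, 0, 0])
    (u₁ := ![0, (a + b - q) / p, (c + d - q) / p, 0]) (u₂ := ![0, 1, 1, 0])
    (u₃ := ![0, 0, 0, (a + b - c - d) / p]) ?_ ?_ ?_ ?_ ?_ ?_ ?_⟩
  · intro v
    refine ⟨p * v 0, p * (v 1 - v 2) / (a + b - c - d),
      v 1 - (v 1 - v 2) / (a + b - c - d) * (a + b - q), p * v 3 / (a + b - c - d), ?_⟩
    ext k
    fin_cases k <;> simp <;> field_simp <;> ring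
  all_goals
    rw [heisenbergExt_apply]
    ext k
    fin_cases k <;> simp [hq] <;> field_simp <;>
      first | ring1 | linear_combination hp | linear_combination -hp

theorem orbit_subset_iUnion_g5 : ∀ m ∈ ⋃ a : ℂ, orbit (g5 a), orbit m ⊆ ⋃ a : ℂ, orbit (g5 a) := by
  intro m hm m' hm'
  simp only [Set.mem_iUnion] at hm ⊢
  obtain ⟨a, h⟩ := hm
  exact ⟨a, mem_orbit_trans hm' h⟩

/-- A Lie algebra with a Heisenberg ideal of codimension one is in the closure of the family
`g5`. -/
theorem mem_closure_g5 {m : AlgStr 4} (hm : m ∈ LieStr 4) {x p q : Fin 4 → ℂ}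
    (hs : Spans x p q (m p q)) (hp : m p (m p q) = 0) (hq : m q (m p q) = 0)
    (h₁ : ∃ a b c : ℂ, m x p = a • p + b • q + c • m p q)
    (h₂ : ∃ a b c : ℂ, m x q = a • p + b • q + c • m p q) :
    m ∈ closure (⋃ a : ℂ, orbit (g5 a)) := by
  obtain ⟨a, c, s, h₁⟩ := h₁
  obtain ⟨b, d, t, h₂⟩ := h₂
  have hz : m x (m p q) = (a + d) • m p q := by
    rw [LieStr.mul_mul hm, h₁, h₂]
    simp [hm.1, hp, LieStr.neg_swap hm (m p q) q, hq]
    module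
  let G : ℂ → ℂ → ℂ → ℂ := fun u v s => u + s * (v - u)
  have hG : ∀ u v, G u v ∈ polyFun := fun u v =>
    add_mem (const_mem polyFun u) (mul_mem id_mem_polyFun (const_mem polyFun _))
  have hG0 : ∀ u v, G u v 0 = u := by simp [G]
  have hG1 : ∀ u v, G u v 1 = v := by simp [G]
  -- The line runs from the given action to `diag(1, 2)`, which is invertible and has `(1, 1)` as a
  -- cyclic vector.
  have hcurve : PolyCurve fun s => heisenbergExt (G a 1 s) (G b 0 s) (G c 0 s) (G d 2 s) := by
    have h0 : (fun _ : ℂ => (0 : ℂ)) ∈ polyFun := const_mem _ _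
    refine polyCurve_anticomm ?_ ?_ ?_ (fun k => const_mem _ _) (fun k => const_mem _ _)
      (fun k => const_mem _ _) <;> intro k <;> fin_cases k <;>
      first | exact h0 | exact hG _ _ | exact add_mem (hG _ _) (hG _ _)
  refine mem_closure_of_orbit_curve orbit_subset_iUnion_g5 hcurve
    (B := {s | G a 1 s * G d 2 s - G b 0 s * G c 0 s = 0} ∪
      {s | G c 0 s + G d 2 s - G a 1 s - G b 0 s = 0}) ?_ ?_ ?_
  · refine (finite_zeros_of_mem_polyFun (sub_mem (mul_mem (hG _ _) (hG _ _))
      (mul_mem (hG _ _) (hG _ _))) (t₀ := 1) ?_).union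
      (finite_zeros_of_mem_polyFun (sub_mem (sub_mem (add_mem (hG _ _) (hG _ _)) (hG _ _))
        (hG _ _)) (t₀ := 1) ?_)
    · simp [hG1]
    · simp [hG1]
      norm_num
  · intro t ht
    simp only [Set.mem_union, Set.mem_ofPred_eq, not_or] at ht
    simpa only [Set.mem_iUnion] using heisenbergExt_mem_orbit ht.1 ht.2
  · simp only [hG0]
    -- Adding `s • q - t • p` changes the action of `x` by an inner derivation that cancels the
    -- central components of `m x p` and `m x q`.
    refine mem_orbit_anticomm hm (u₀ := x + s • q - t • p) (u₁ := p) (u₂ := q) (u₃ := m p q)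
      ?_ ?_ ?_ ?_ ?_ ?_ ?_
    · exact hs.trans ⟨1, t, -s, 0, by module⟩ ⟨0, 1, 0, 0, by module⟩ ⟨0, 0, 1, 0, by module⟩
        ⟨0, 0, 0, 1, by module⟩
    · simp [h₁, hm.1, LieStr.neg_swap hm q p]
    · simp [h₂, hm.1]
    · simp [hz, hp, hq]
    · simp
    · simp [hp]
    · simp [hq]

/-! ### Nilpotent Lie algebras -/

/-- The union of the four closed sets. -/
def fourFamilies : Set (AlgStr 4) :=
  closure (orbit sl2) ∪ closure (orbit R2) ∪ closure (⋃ a : ℂ, orbit (g5 a)) ∪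
    closure (⋃ a : ℂ, ⋃ b : ℂ, orbit (g4 a b))

/-- The space `ℂⁿ` with the Lie bracket given by a Lie algebra structure. -/
def LieSpace {n : ℕ} {m : AlgStr n} (_ : m ∈ LieStr n) : Type := Fin n → ℂ

section LieSpace

variable {n : ℕ} {m : AlgStr n} (hm : m ∈ LieStr n)

instance : AddCommGroup (LieSpace hm) := inferInstanceAs (AddCommGroup (Fin n → ℂ))

instance : Module ℂ (LieSpace hm) := inferInstanceAs (Module ℂ (Fin n → ℂ))

instance : FiniteDimensional ℂ (LieSpace hm) :=
  inferInstanceAs (FiniteDimensional ℂ (Fin n → ℂ))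

instance : LieRing (LieSpace hm) where
  bracket x y := m x y
  add_lie x y z := LinearMap.map_add₂ m x y z
  lie_add x y z := map_add (m x) y z
  lie_self x := hm.1 x
  leibniz_lie x y z := LieStr.mul_mul hm x y z

instance : LieAlgebra ℂ (LieSpace hm) where
  lie_smul a x y := map_smul (m x) a y

end LieSpace

/-- A form of Engel's theorem. -/
theorem exists_notMem_of_isNilpotent {n : ℕ} {m : AlgStr n} (hm : m ∈ LieStr n)
    (h : ∀ x, IsNilpotent (m x : Module.End ℂ (Fin n → ℂ))) (N : Submodule ℂ (Fin n → ℂ))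
    (hN : N ≠ ⊤) : ∃ v ∉ N, ∀ x, m x v ∈ N := by
  have hnil : LieRing.IsNilpotent (LieSpace hm) :=
    (LieAlgebra.isNilpotent_iff_forall (R := ℂ)).2 fun x => h x
  obtain ⟨k, hk⟩ := LieModule.IsNilpotent.nilpotent ℂ (LieSpace hm) (LieSpace hm)
  let C : ℕ → Submodule ℂ (Fin n → ℂ) := fun k =>
    (LieModule.lowerCentralSeries ℂ (LieSpace hm) (LieSpace hm) k).toSubmodule
  have hex : ∃ k, C k ≤ N := ⟨k, by simp only [C, hk]; exact bot_le⟩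
  classical
  -- The first term of the lower central series inside `N` is not the zeroth, which is the whole
  -- space. A vector of the preceding term outside `N` is the one sought.
  obtain ⟨j, hj⟩ : ∃ j, Nat.find hex = j + 1 := by
    refine Nat.exists_eq_succ_of_ne_zero fun h0 => hN ?_
    have := Nat.find_spec hex
    rw [h0] at this
    exact top_le_iff.1 this
  obtain ⟨v, hv, hvN⟩ := Set.not_subset.1 (Nat.find_min hex (m := j) (by omega))
  refine ⟨v, hvN, fun x => ?_⟩
  have h1 := Nat.find_spec hex
  rw [hj] at h1
  refine h1 ?_
  let x' : LieSpace hm := x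
  let v' : LieSpace hm := v
  have hv' : v' ∈ LieModule.lowerCentralSeries ℂ (LieSpace hm) (LieSpace hm) j := hv
  have : ⁅x', v'⁆ ∈ LieModule.lowerCentralSeries ℂ (LieSpace hm) (LieSpace hm) (j + 1) := by
    rw [LieModule.lowerCentralSeries_succ]
    exact LieSubmodule.lie_mem_lie (LieSubmodule.mem_top _) hv'
  exact this

/-- Engel's theorem gives a flag in which every multiplication lowers the level. Either `v₃, v₂, v₁`
commute, or some combination of `v₄` and `v₃` commutes with `v₂`; in both cases there is an abelian
ideal of codimension one. -/
theorem mem_fourFamilies_of_isNilpotent {m : AlgStr 4} (hm : m ∈ LieStr 4)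
    (h : ∀ x, IsNilpotent (m x : Module.End ℂ (Fin 4 → ℂ))) : m ∈ fourFamilies := by
  refine Or.inr ?_
  have hstep : ∀ {k : ℕ} (v : Fin k → Fin 4 → ℂ), LinearIndependent ℂ v → k < 4 →
      ∃ w, LinearIndependent ℂ (Fin.cons w v : Fin (k + 1) → Fin 4 → ℂ) ∧
        ∀ x, m x w ∈ Submodule.span ℂ (Set.range v) := by
    intro k v hv hk
    obtain ⟨w, hw, hw'⟩ := exists_notMem_of_isNilpotent hm h (Submodule.span ℂ (Set.range v)) (by
      intro htop
      have := finrank_span_eq_card hv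
      rw [htop, finrank_top] at this
      simp at this
      omega)
    exact ⟨w, linearIndependent_finCons.2 ⟨hv, hw⟩, hw'⟩
  obtain ⟨v₁, h₁, c₁⟩ := hstep ![] linearIndependent_empty_type (by norm_num)
  obtain ⟨v₂, h₂, c₂⟩ := hstep ![v₁] h₁ (by norm_num)
  obtain ⟨v₃, h₃, c₃⟩ := hstep ![v₂, v₁] h₂ (by norm_num)
  obtain ⟨v₄, h₄, -⟩ := hstep ![v₃, v₂, v₁] h₃ (by norm_num)
  have hs : Spans v₄ v₃ v₂ v₁ := Spans.of_linearIndependent h₄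
  have c₁ : ∀ x, m x v₁ = 0 := fun x => by simpa using c₁ x
  have c₁' : ∀ x, m v₁ x = 0 := fun x => by rw [LieStr.neg_swap hm, c₁, neg_zero]
  have c₂ : ∀ x, ∃ s : ℂ, s • v₁ = m x v₂ := fun x => by
    simpa [Submodule.mem_span_singleton] using c₂ x
  have c₃ : ∀ x, ∃ s t : ℂ, s • v₁ + t • v₂ = m x v₃ := fun x => by
    simpa [Submodule.mem_span_pair] using c₃ x
  obtain ⟨s, hs₃₂⟩ := c₂ v₃
  obtain ⟨t, hs₄₂⟩ := c₂ v₄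
  obtain ⟨q, p, hs₄₃⟩ := c₃ v₄
  by_cases hs0 : s = 0
  · subst hs0
    rw [zero_smul] at hs₃₂
    refine mem_closure_g4 hm hs hs₃₂.symm (c₁ _) (c₁ _) ⟨0, p, q, ?_⟩ ⟨0, 0, t, ?_⟩ ⟨0, 0, 0, ?_⟩
    · rw [← hs₄₃]; module
    · rw [← hs₄₂]; module
    · rw [c₁]; module
  · refine mem_closure_g4 hm (x := v₃) (u₁ := v₄ - (t / s) • v₃) (u₂ := v₂) (u₃ := v₁)
      (hs.trans ⟨t / s, 1, 0, 0, by module⟩ ⟨1, 0, 0, 0, by module⟩ ⟨0, 0, 1, 0, by module⟩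
        ⟨0, 0, 0, 1, by module⟩) ?_ (c₁ _) (c₁ _) ⟨0, -p, -q, ?_⟩ ⟨0, 0, s, ?_⟩ ⟨0, 0, 0, ?_⟩
    · simp only [map_sub, map_smul, LinearMap.sub_apply, LinearMap.smul_apply, ← hs₄₂, ← hs₃₂,
        smul_smul]
      rw [div_mul_cancel₀ _ hs0, sub_self]
    · simp only [map_sub, map_smul, hm.1, LieStr.neg_swap hm v₃ v₄, ← hs₄₃]
      module
    · rw [← hs₃₂]; module
    · rw [c₁]; module

/-! ### The Fitting decomposition and invariant flags -/

/-- Fitting decomposition. -/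
theorem exists_fitting {V : Type*} [AddCommGroup V] [Module ℂ V] [FiniteDimensional ℂ V]
    (D : Module.End ℂ V) : ∃ H W : Submodule ℂ V, IsCompl H W ∧
      (∀ v, v ∈ H ↔ ∃ k : ℕ, (D ^ k) v = 0) ∧
      (∀ T : Module.End ℂ V, Commute T D → ∀ w ∈ W, T w ∈ W) ∧ ∀ w ∈ W, ∃ w' ∈ W, D w' = w := by
  obtain ⟨N, hN⟩ := Filter.eventually_atTop.1 (LinearMap.eventually_isCompl_ker_pow_range_pow D)
  -- The bound `N` makes kernel and range complementary, the dimension makes the kernel contain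
  -- everything killed by some power, and the extra `1` lets one factor `D` be split off `D ^ n` for
  -- the surjectivity on `W`.
  set n := max N (Module.finrank ℂ V) + 1 with hn
  have hc := hN n (by omega)
  refine ⟨_, _, hc, fun v => ⟨fun h => ⟨n, h⟩, ?_⟩, ?_, ?_⟩
  · rintro ⟨k, hk⟩
    have h1 := Module.End.ker_pow_le_ker_pow_finrank D k hk
    rw [LinearMap.mem_ker] at h1 ⊢
    rw [show n = (n - Module.finrank ℂ V) + Module.finrank ℂ V by omega, pow_add,
      Module.End.mul_apply, h1, map_zero]
  · rintro T hT _ ⟨u, rfl⟩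
    exact ⟨T u, by rw [← Module.End.mul_apply, ← Module.End.mul_apply, (hT.pow_right n).eq]⟩
  · rintro _ ⟨u, rfl⟩
    obtain ⟨h, hh, w, ⟨u', rfl⟩, rfl⟩ : ∃ h ∈ LinearMap.ker (D ^ n),
        ∃ w ∈ LinearMap.range (D ^ n), h + w = u := by
      have : u ∈ LinearMap.ker (D ^ n) ⊔ LinearMap.range (D ^ n) := by
        rw [hc.sup_eq_top]; trivial
      exact Submodule.mem_sup.1 this
    refine ⟨(D ^ (n - 1)) ((D ^ n) u'), ⟨(D ^ (n - 1)) u', ?_⟩, ?_⟩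
    · simp only [← Module.End.mul_apply, ← pow_add, add_comm]
    · rw [map_add, LinearMap.mem_ker.1 hh, zero_add, ← Module.End.mul_apply, ← pow_succ',
        Nat.sub_add_cancel (by omega)]

/-- A flag of invariant subspaces in dimension three. -/
theorem exists_flag {V : Type*} [AddCommGroup V] [Module ℂ V] [FiniteDimensional ℂ V]
    (hV : Module.finrank ℂ V = 3) (D : Module.End ℂ V) : ∃ e f g : V, ∃ a b c r q p : ℂ,
      LinearIndependent ℂ ![e, f, g] ∧ D e = a • e ∧ D f = b • f + r • e ∧
      D g = c • g + q • f + p • e := by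
  have : Nontrivial V := Module.nontrivial_of_finrank_pos (R := ℂ) (by omega)
  obtain ⟨a, ha⟩ := Module.End.exists_eigenvalue D
  obtain ⟨e, he⟩ := ha.exists_hasEigenvector
  have hDe : D e = a • e := he.apply_eq_smul
  have hle : Submodule.span ℂ {e} ≤ (Submodule.span ℂ {e}).comap D := by
    rw [Submodule.span_singleton_le_iff_mem, Submodule.mem_comap, hDe]
    exact Submodule.smul_mem _ _ (Submodule.mem_span_singleton_self e)
  let D' : Module.End ℂ (V ⧸ Submodule.span ℂ {e}) := Submodule.mapQ _ _ D hle
  have hfin := Submodule.finrank_quotient_add_finrank (Submodule.span ℂ {e})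
  rw [finrank_span_singleton he.2, hV] at hfin
  have : Nontrivial (V ⧸ Submodule.span ℂ {e}) :=
    Module.nontrivial_of_finrank_pos (R := ℂ) (by omega)
  obtain ⟨b, hb⟩ := Module.End.exists_eigenvalue D'
  obtain ⟨f', hf'⟩ := hb.exists_hasEigenvector
  obtain ⟨f, rfl⟩ := Submodule.Quotient.mk_surjective _ f'
  have hf0 : f ∉ Submodule.span ℂ {e} := fun h =>
    hf'.2 ((Submodule.Quotient.mk_eq_zero _).2 h)
  have hDf : D f - b • f ∈ Submodule.span ℂ {e} := by
    have := hf'.apply_eq_smul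
    rw [Submodule.mapQ_apply, ← Submodule.Quotient.mk_smul] at this
    exact (Submodule.Quotient.eq _).1 this
  obtain ⟨r, hr⟩ := Submodule.mem_span_singleton.1 hDf
  have hli2 : LinearIndependent ℂ ![f, e] :=
    linearIndependent_finCons.2 ⟨by simpa using he.2, by simpa using hf0⟩
  obtain ⟨g, hg⟩ : ∃ g, g ∉ Submodule.span ℂ (Set.range ![f, e]) := by
    by_contra! hall
    have h1 := finrank_span_eq_card hli2
    rw [(Submodule.eq_top_iff'.2 hall), finrank_top, hV] at h1
    simp at h1
  have hli3 : LinearIndependent ℂ ![g, f, e] := linearIndependent_finCons.2 ⟨hli2, hg⟩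
  let B := basisOfLinearIndependentOfCardEqFinrank hli3 (by simp [hV])
  have hB := B.sum_repr (D g)
  simp only [B, Fin.sum_univ_three, coe_basisOfLinearIndependentOfCardEqFinrank,
    Matrix.cons_val] at hB
  refine ⟨e, f, g, a, b, _, r, _, _, ?_, hDe, ?_, hB.symm⟩
  · have := hli3.comp ![2, 1, 0] (by decide)
    convert this using 1
    ext i
    fin_cases i <;> rfl
  · rw [hr]; abel

/-- `H` and `W` are the Fitting components of `D`. -/
structure IsFitting {V : Type*} [AddCommGroup V] [Module ℂ V] (D : Module.End ℂ V)
    (H W : Submodule ℂ V) : Prop where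
  compl : IsCompl H W
  mem_iff : ∀ v, v ∈ H ↔ ∃ k : ℕ, (D ^ k) v = 0
  comm : ∀ T : Module.End ℂ V, Commute T D → ∀ w ∈ W, T w ∈ W
  surj : ∀ w ∈ W, ∃ w' ∈ W, D w' = w

namespace IsFitting

variable {V : Type*} [AddCommGroup V] [Module ℂ V] {D : Module.End ℂ V} {H W : Submodule ℂ V}

theorem exists_add (h : IsFitting D H W) (v : V) : ∃ u ∈ H, ∃ w ∈ W, v = u + w := by
  have : v ∈ H ⊔ W := by rw [h.compl.sup_eq_top]; trivial
  obtain ⟨u, hu, w, hw, rfl⟩ := Submodule.mem_sup.1 this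
  exact ⟨u, hu, w, hw, rfl⟩

theorem eq_zero_of_mem (h : IsFitting D H W) {v : V} (h₁ : v ∈ H) (h₂ : v ∈ W) : v = 0 :=
  Submodule.disjoint_def.1 h.compl.disjoint v h₁ h₂

theorem map_mem_right (h : IsFitting D H W) {w : V} (hw : w ∈ W) : D w ∈ W :=
  h.comm D (Commute.refl D) w hw

theorem map_mem_left (h : IsFitting D H W) {v : V} (hv : v ∈ H) : D v ∈ H := by
  obtain ⟨k, hk⟩ := (h.mem_iff v).1 hv
  refine (h.mem_iff _).2 ⟨k, ?_⟩
  rw [← Module.End.mul_apply, ← pow_succ, pow_succ', Module.End.mul_apply, hk, map_zero]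

theorem mem_of_map_mem (h : IsFitting D H W) {v : V} (hv : D v ∈ H) : v ∈ H := by
  obtain ⟨k, hk⟩ := (h.mem_iff _).1 hv
  exact (h.mem_iff _).2 ⟨k + 1, by rw [pow_succ, Module.End.mul_apply, hk]⟩

theorem eq_zero_of_eigen (h : IsFitting D H W) {v : V} (hv : v ∈ H) {c : ℂ} (hc : c ≠ 0)
    (hD : D v = c • v) : v = 0 := by
  obtain ⟨k, hk⟩ := (h.mem_iff v).1 hv
  have : ∀ k : ℕ, (D ^ k) v = c ^ k • v := fun k => by
    induction k with
    | zero => simp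
    | succ k ih => rw [pow_succ, Module.End.mul_apply, hD, map_smul, ih, smul_smul, pow_succ']
  rw [this, smul_eq_zero] at hk
  exact hk.resolve_left (pow_ne_zero _ hc)

/-- On `H` the map `D` is locally nilpotent, so `D - c` is injective there and the `H`-component of
`v` must vanish. -/
theorem mem_right_of_eigen (h : IsFitting D H W) {v : V} {c : ℂ} (hc : c ≠ 0)
    (hD : D v - c • v ∈ W) : v ∈ W := by
  obtain ⟨u, hu, w, hw, rfl⟩ := h.exists_add v
  have h1 : D u - c • u ∈ W := by
    have := sub_mem hD (sub_mem (h.map_mem_right hw) (W.smul_mem c hw))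
    convert this using 1
    rw [map_add]
    module
  have h2 := h.eq_zero_of_mem (sub_mem (h.map_mem_left hu) (H.smul_mem c hu)) h1
  rw [h.eq_zero_of_eigen hu hc (sub_eq_zero.1 h2), zero_add]
  exact hw

theorem eigenvalue_ne_zero (h : IsFitting D H W) {w : V} (hw : w ∈ W) (hw0 : w ≠ 0) {c : ℂ}
    (hD : D w = c • w) : c ≠ 0 := by
  rintro rfl
  exact hw0 (h.eq_zero_of_mem ((h.mem_iff w).2 ⟨1, by simpa using hD⟩) hw)

end IsFitting

/-- `m x` is a derivation, so it sends `uv` to a sum of products in which one factor needs one power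
less to be killed; induct on the sum of the two exponents. -/
theorem IsFitting.mul_mem {n : ℕ} {m : AlgStr n} (hm : m ∈ LieStr n) {x : Fin n → ℂ}
    {H W : Submodule ℂ (Fin n → ℂ)} (h : IsFitting (m x) H W) {u v : Fin n → ℂ} (hu : u ∈ H)
    (hv : v ∈ H) : m u v ∈ H := by
  have key : ∀ N k l : ℕ, k + l = N → ∀ u v, ((m x : Module.End ℂ _) ^ k) u = 0 →
      ((m x : Module.End ℂ _) ^ l) v = 0 → m u v ∈ H := by
    intro N
    induction N with
    | zero =>
      intro k l hkl u v hu hv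
      obtain rfl : k = 0 := by omega
      simp only [pow_zero, Module.End.one_apply] at hu
      simp [hu]
    | succ N ih =>
      intro k l hkl u v hu hv
      rcases k with _ | k
      · simp only [pow_zero, Module.End.one_apply] at hu
        simp [hu]
      rcases l with _ | l
      · simp only [pow_zero, Module.End.one_apply] at hv
        simp [hv]
      refine h.mem_of_map_mem ?_
      rw [LieStr.mul_mul hm]
      refine add_mem (ih k (l + 1) (by omega) _ _ ?_ hv) (ih (k + 1) l (by omega) _ _ hu ?_)
      · rwa [pow_succ, Module.End.mul_apply] at hu
      · rwa [pow_succ, Module.End.mul_apply] at hv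
  obtain ⟨k, hk⟩ := (h.mem_iff u).1 hu
  obtain ⟨l, hl⟩ := (h.mem_iff v).1 hv
  exact key _ k l rfl u v hk hl

/-! ### Classification by the dimension of the Fitting component `W` -/

theorem mem_fourFamilies_of_finrank_one {m : AlgStr 4} (hm : m ∈ LieStr 4) {x : Fin 4 → ℂ}
    {H W : Submodule ℂ (Fin 4 → ℂ)} (h : IsFitting (m x) H W) (hW : Module.finrank ℂ W = 1) :
    m ∈ fourFamilies := by
  have hsum := Submodule.finrank_add_eq_of_isCompl h.compl
  rw [hW, Module.finrank_fin_fun] at hsum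
  have hxx := hm.1 x
  have hxH : x ∈ H := (h.mem_iff x).2 ⟨1, by simpa using hxx⟩
  obtain ⟨⟨w, hw⟩, hw0, hwW⟩ := finrank_eq_one_iff'.1 hW
  have hw0 : w ≠ 0 := fun h0 => hw0 (by simpa using h0)
  have hwW : ∀ v ∈ W, ∃ c : ℂ, v = c • w := fun v hv => by
    obtain ⟨c, hc⟩ := hwW ⟨v, hv⟩
    exact ⟨c, (congrArg Subtype.val hc).symm⟩
  obtain ⟨a, ha⟩ := hwW _ (h.map_mem_right hw)
  have ha0 : a ≠ 0 := h.eigenvalue_ne_zero hw hw0 ha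
  have hχ : ∀ u ∈ H, ∃ c : ℂ, m u w = c • w := by
    intro u hu
    obtain ⟨k, hk⟩ := (h.mem_iff u).1 hu
    clear hu
    induction k generalizing u with
    | zero => exact ⟨0, by simp only [pow_zero, Module.End.one_apply] at hk; simp [hk]⟩
    | succ k ih =>
      obtain ⟨c, hc⟩ := ih (m x u) (by rwa [pow_succ, Module.End.mul_apply] at hk)
      refine hwW _ (h.mem_right_of_eigen ha0 ?_)
      rw [LieStr.mul_mul hm, hc, ha, map_smul, add_sub_cancel_right]
      exact W.smul_mem _ hw
  -- `H` acts on the line `W` by a weight that is nonzero on `x`. The kernel `K` of this weight is a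
  -- plane, stable under `x` and closed under products. If it is abelian, then `W` and `K` span an
  -- abelian ideal; if not, the algebra is `R2`.
  let K : Submodule ℂ (Fin 4 → ℂ) := H ⊓ LinearMap.ker (m.flip w)
  have hKmem : ∀ u, u ∈ K ↔ u ∈ H ∧ m u w = 0 := fun u => Iff.rfl
  have hx0 : x ≠ 0 := by
    rintro rfl
    rw [map_zero, LinearMap.zero_apply] at ha
    exact smul_ne_zero ha0 hw0 ha.symm
  have hKH : K ⊔ Submodule.span ℂ {x} = H := by
    refine le_antisymm (sup_le inf_le_left (by simpa using hxH)) fun u hu => ?_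
    obtain ⟨c, hc⟩ := hχ u hu
    refine Submodule.mem_sup.2 ⟨u - (c / a) • x, (hKmem _).2 ⟨sub_mem hu (H.smul_mem _ hxH), ?_⟩,
      (c / a) • x, Submodule.smul_mem _ _ (Submodule.mem_span_singleton_self x), by abel⟩
    rw [map_sub, LinearMap.sub_apply, map_smul, LinearMap.smul_apply, ha, hc, smul_smul,
      div_mul_cancel₀ _ ha0, sub_self]
  have hKx : K ⊓ Submodule.span ℂ {x} = ⊥ := by
    rw [eq_bot_iff]
    rintro u ⟨hu, hux⟩
    obtain ⟨c, rfl⟩ := Submodule.mem_span_singleton.1 hux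
    have := ((hKmem _).1 hu).2
    rw [map_smul, LinearMap.smul_apply, ha, smul_smul, smul_eq_zero, mul_eq_zero] at this
    rcases this with (h' | h') | h'
    · simp [h']
    · exact absurd h' ha0
    · exact absurd h' hw0
  have hK := Submodule.finrank_sup_add_finrank_inf_eq K (Submodule.span ℂ {x})
  rw [hKH, hKx, finrank_bot, finrank_span_singleton hx0] at hK
  let B := Module.finBasisOfFinrankEq ℂ K (n := 2) (by omega)
  obtain ⟨⟨u, hu⟩, hBu⟩ : ∃ u, u = B 0 := ⟨_, rfl⟩
  obtain ⟨⟨v, hv⟩, hBv⟩ : ∃ v, v = B 1 := ⟨_, rfl⟩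
  have hspan : ∀ y ∈ K, ∃ s t : ℂ, y = s • u + t • v := by
    intro y hy
    have := B.sum_repr ⟨y, hy⟩
    rw [Fin.sum_univ_two, ← hBu, ← hBv] at this
    exact ⟨_, _, (congrArg Subtype.val this).symm⟩
  have hS : Spans x w u v := by
    intro y
    obtain ⟨y₁, h₁, y₂, h₂, rfl⟩ := h.exists_add y
    rw [← hKH] at h₁
    obtain ⟨y₃, h₃, y₄, h₄, rfl⟩ := Submodule.mem_sup.1 h₁
    obtain ⟨c, rfl⟩ := Submodule.mem_span_singleton.1 h₄
    obtain ⟨d, rfl⟩ := hwW _ h₂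
    obtain ⟨s, t, rfl⟩ := hspan _ h₃
    exact ⟨c, d, s, t, by module⟩
  have huw : m u w = 0 := hu.2
  have hvw : m v w = 0 := hv.2
  have hKD : ∀ y ∈ K, m x y ∈ K := by
    rintro y hy
    have hyw : m y w = 0 := hy.2
    refine (hKmem _).2 ⟨h.map_mem_left hy.1, ?_⟩
    have := LieStr.mul_mul hm x y w
    rw [hyw, ha, map_smul, hyw, map_zero, smul_zero, add_zero] at this
    exact this.symm
  have hKK : m u v ∈ K := by
    refine (hKmem _).2 ⟨h.mul_mem hm hu.1 hv.1, ?_⟩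
    have := LieStr.mul_mul hm u v w
    rw [huw, hvw, map_zero, map_zero, add_zero] at this
    exact this.symm
  obtain ⟨p, q, hxu⟩ := hspan _ (hKD u hu)
  obtain ⟨r, s, hxv⟩ := hspan _ (hKD v hv)
  by_cases h0 : m u v = 0
  · refine Or.inr (mem_closure_g4 hm hS ?_ ?_ h0 ⟨a, 0, 0, by rw [ha]; module⟩
      ⟨0, p, q, by rw [hxu]; module⟩ ⟨0, r, s, by rw [hxv]; module⟩)
    · rw [LieStr.neg_swap hm, huw, neg_zero]
    · rw [LieStr.neg_swap hm, hvw, neg_zero]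
  · obtain ⟨y, hy⟩ : ∃ y, y = m u v := ⟨_, rfl⟩
    rw [← hy] at hKK h0
    have hxy0 : m x y = (p + s) • y := by
      rw [hy, LieStr.mul_mul hm, hxu, hxv]
      simp [hm.1]
      module
    -- `x` acts on `uv` by its trace on `K`, and a nonzero eigenvalue is impossible inside `H`.
    have hps : p + s = 0 := by
      by_contra hne
      exact h0 (h.eq_zero_of_eigen hKK.1 hne hxy0)
    rw [hps, zero_smul] at hxy0
    obtain ⟨α, β, hyuv⟩ := hspan _ hKK
    obtain ⟨u', hu', hu'y, hspan'⟩ : ∃ u' ∈ K, m u' y = y ∧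
        ∀ z ∈ K, ∃ s t : ℂ, z = s • u' + t • y := by
      by_cases hβ : β = 0
      · have hα : α ≠ 0 := by
          rintro rfl
          exact h0 (by simp [hyuv, hβ])
        refine ⟨-(α⁻¹ • v), neg_mem (K.smul_mem _ hv), ?_, fun z hz => ?_⟩
        · have : m v y = -α • y := by
            conv_lhs => rw [hyuv]
            rw [hβ, map_add, map_smul, map_smul, hm.1, LieStr.neg_swap hm v u, ← hy]
            module
          rw [map_neg, map_smul, LinearMap.neg_apply, LinearMap.smul_apply, this, smul_smul]
          rw [mul_neg, inv_mul_cancel₀ hα]; simp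
        · obtain ⟨s, t, rfl⟩ := hspan z hz
          refine ⟨-(α * t), s / α, ?_⟩
          rw [hyuv, hβ]
          match_scalars <;> field_simp
          ring
      · refine ⟨β⁻¹ • u, K.smul_mem _ hu, ?_, fun z hz => ?_⟩
        · have : m u y = β • y := by
            conv_lhs => rw [hyuv]
            rw [map_add, map_smul, map_smul, hm.1, ← hy]
            module
          rw [map_smul, LinearMap.smul_apply, this, smul_smul, inv_mul_cancel₀ hβ, one_smul]
        · obtain ⟨s, t, rfl⟩ := hspan z hz
          refine ⟨β * s - α * t, t / β, ?_⟩
          rw [hyuv]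
          match_scalars <;> field_simp
          ring
    obtain ⟨σ, τ, hxu'⟩ := hspan' _ (hKD u' hu')
    have hσ : σ = 0 := by
      have := LieStr.mul_mul hm x u' y
      rw [hu'y, hxy0, map_zero, add_zero, hxu', map_add, LinearMap.add_apply, map_smul, map_smul,
        LinearMap.smul_apply, LinearMap.smul_apply, hu'y, hm.1, smul_zero, add_zero] at this
      exact (smul_eq_zero.1 this.symm).resolve_right h0
    rw [hσ, zero_smul, zero_add] at hxu'
    have hS' : Spans x w u' y := by
      have hu2 := hspan' u hu
      have hv2 := hspan' v hv
      obtain ⟨s₁, t₁, e₁⟩ := hu2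
      obtain ⟨s₂, t₂, e₂⟩ := hv2
      exact hS.trans ⟨1, 0, 0, 0, by module⟩ ⟨0, 1, 0, 0, by module⟩
        ⟨0, 0, s₁, t₁, by rw [e₁]; module⟩ ⟨0, 0, s₂, t₂, by rw [e₂]; module⟩
    have hu'w : m u' w = 0 := hu'.2
    have hyw : m y w = 0 := hKK.2
    -- On `K` the map `m x` is the inner derivation by `-τ • y`, so `x + τ • y` centralizes `K` and
    -- still scales `w` by `a`. The algebra is the sum of two nonabelian planes.
    refine Or.inl (Or.inl (Or.inr (subset_closure ?_)))
    refine mem_orbit_anticomm hm (u₀ := u') (u₁ := y) (u₂ := a⁻¹ • (x + τ • y)) (u₃ := w)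
      ?_ ?_ ?_ ?_ ?_ ?_ ?_
    · refine hS'.trans ⟨0, -τ, a, 0, ?_⟩ ⟨0, 0, 0, 1, by module⟩ ⟨1, 0, 0, 0, by module⟩
        ⟨0, 1, 0, 0, by module⟩
      match_scalars <;> field_simp
      ring
    · simp [hu'y]
    · simp [LieStr.neg_swap hm u' x, hxu', hu'y]
    · simp [hu'w]
    · simp [LieStr.neg_swap hm y x, hxy0, hm.1]
    · simp [hyw]
    · simp [ha, hyw, ha0]

theorem exists_pair_of_finrank_two {V : Type*} [AddCommGroup V] [Module ℂ V]
    [FiniteDimensional ℂ V] {W : Submodule ℂ V} (hW : Module.finrank ℂ W = 2) {e : V} (he : e ∈ W)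
    (he0 : e ≠ 0) : ∃ f ∈ W, (∀ c : ℂ, f ≠ c • e) ∧ ∀ w ∈ W, ∃ s t : ℂ, w = s • e + t • f := by
  obtain ⟨⟨f, hf⟩, hli⟩ := exists_linearIndependent_pair_of_one_lt_finrank (R := ℂ)
    (x := (⟨e, he⟩ : W)) (by omega) (fun h => he0 (congrArg Subtype.val h))
  let B := basisOfLinearIndependentOfCardEqFinrank hli (by simp [hW])
  refine ⟨f, hf, ?_, fun w hw => ?_⟩
  · rintro c rfl
    have := LinearIndependent.pair_iff.1 hli (-c) 1 (by ext; simp)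
    simp at this
  · have := B.sum_repr ⟨w, hw⟩
    simp only [B, Fin.sum_univ_two, coe_basisOfLinearIndependentOfCardEqFinrank,
      Matrix.cons_val] at this
    exact ⟨_, _, (congrArg Subtype.val this).symm⟩

theorem exists_common_eigenvector {V : Type*} [AddCommGroup V] [Module ℂ V]
    [FiniteDimensional ℂ V] {X Y : Module.End ℂ V} (hXY : Commute X Y) {W : Submodule ℂ V}
    (hW : W ≠ ⊥) (hX : ∀ w ∈ W, X w ∈ W) (hY : ∀ w ∈ W, Y w ∈ W) :
    ∃ e ∈ W, e ≠ 0 ∧ ∃ a b : ℂ, X e = a • e ∧ Y e = b • e := by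
  have key : ∀ (T : Module.End ℂ V) (U : Submodule ℂ V), U ≠ ⊥ → (∀ w ∈ U, T w ∈ U) →
      ∃ e ∈ U, e ≠ 0 ∧ ∃ a : ℂ, T e = a • e := by
    intro T U hU hT
    have : Nontrivial U := Submodule.nontrivial_iff_ne_bot.2 hU
    obtain ⟨a, ha⟩ := Module.End.exists_eigenvalue (T.restrict hT)
    obtain ⟨⟨e, he⟩, hv⟩ := ha.exists_hasEigenvector
    exact ⟨e, he, fun h => hv.2 (Subtype.ext h), a, congrArg Subtype.val hv.apply_eq_smul⟩
  obtain ⟨e, he, he0, a, ha⟩ := key X W hW hX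
  obtain ⟨e', ⟨he', hea⟩, he'0, b, hb⟩ := key Y (W ⊓ X.eigenspace a)
    (fun h => he0 ((Submodule.eq_bot_iff _).1 h e ⟨he, Module.End.mem_eigenspace_iff.2 ha⟩))
    (fun w hw => ⟨hY w hw.1, Module.End.mem_eigenspace_iff.2 (by
      rw [← Module.End.mul_apply, hXY.eq, Module.End.mul_apply,
        Module.End.mem_eigenspace_iff.1 hw.2, map_smul])⟩)
  exact ⟨e', he', he'0, a, b, Module.End.mem_eigenspace_iff.1 hea, hb⟩

theorem Spans.coeff_eq_zero {u₀ u₁ u₂ u₃ : Fin 4 → ℂ} (h : Spans u₀ u₁ u₂ u₃) {a b c d : ℂ}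
    (h0 : a • u₀ + b • u₁ + c • u₂ + d • u₃ = 0) : a = 0 ∧ b = 0 ∧ c = 0 ∧ d = 0 := by
  obtain ⟨B, hB⟩ := h.exists_basis
  have := Fintype.linearIndependent_iff.1 B.linearIndependent ![a, b, c, d] (by
    simpa [Fin.sum_univ_four, hB] using h0)
  exact ⟨this 0, this 1, this 2, this 3⟩

/-- `H` is an abelian plane, and a vector `y₁` of it kills an eigenvector `e` of `x` in `W`. The
action of `y₁` on `W` decides: a nonzero eigenvalue gives `R2`, a nonzero nilpotent action gives a
Heisenberg ideal, and for zero action the product `ef ∈ H` distinguishes the abelian ideal, the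
Heisenberg ideal and `sl2`. -/
theorem mem_fourFamilies_of_finrank_two {m : AlgStr 4} (hm : m ∈ LieStr 4) {x : Fin 4 → ℂ}
    {H W : Submodule ℂ (Fin 4 → ℂ)} (h : IsFitting (m x) H W) (hW : Module.finrank ℂ W = 2) :
    m ∈ fourFamilies := by
  have hsum := Submodule.finrank_add_eq_of_isCompl h.compl
  rw [hW, Module.finrank_fin_fun] at hsum
  have hxx := hm.1 x
  have hxH : x ∈ H := (h.mem_iff x).2 ⟨1, by simpa using hxx⟩
  have hWbot : W ≠ ⊥ := by
    rintro rfl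
    simp at hW
  have hx0 : x ≠ 0 := by
    rintro rfl
    refine hWbot ((Submodule.eq_bot_iff _).2 fun w hw => ?_)
    obtain ⟨w', -, rfl⟩ := h.surj w hw
    simp
  obtain ⟨y, hyH, -, hspanH⟩ := exists_pair_of_finrank_two (W := H) (by omega) hxH hx0
  have hspans : ∀ {y e f : Fin 4 → ℂ}, (∀ v ∈ H, ∃ s t : ℂ, v = s • x + t • y) →
      (∀ v ∈ W, ∃ s t : ℂ, v = s • e + t • f) → Spans x y e f := by
    intro y e f h₁ h₂ v
    obtain ⟨u, hu, w, hw, rfl⟩ := h.exists_add v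
    obtain ⟨s, t, rfl⟩ := h₁ u hu
    obtain ⟨s', t', rfl⟩ := h₂ w hw
    exact ⟨s, t, s', t', by module⟩
  -- the zero component is abelian
  have hxy : m x y = 0 := by
    obtain ⟨α, β, hαβ⟩ := hspanH _ (h.map_mem_left hyH)
    have hα : ∃ α : ℂ, m x y = α • x := by
      by_cases hβ : β = 0
      · exact ⟨α, by rw [hαβ, hβ]; module⟩
      · have : m x (m x y) = β • m x y := by
          conv_lhs => rw [hαβ]
          rw [map_add, map_smul, map_smul, hxx, smul_zero, zero_add]
        exact ⟨0, by rw [h.eq_zero_of_eigen (h.map_mem_left hyH) hβ this, zero_smul]⟩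
    clear hαβ α β
    obtain ⟨α, hα⟩ := hα
    by_contra hne
    have hα0 : α ≠ 0 := by
      rintro rfl
      exact hne (by rw [hα, zero_smul])
    -- Here the commutator of `m x` and `m y` would be `α` times `m x`. Its diagonal coordinates at
    -- `e` and `f` are `qr = αa` and `-qr = αb`, so `α(a + b) = 0`; since `q ≠ 0` also forces `a =
    -- b`, this contradicts `α, a ≠ 0`.
    have hcomm : ∀ v, m x (m y v) = α • m x v + m y (m x v) := fun v => by
      rw [LieStr.mul_mul hm x y v, hα, map_smul, LinearMap.smul_apply]
    obtain ⟨e, he, he0, a, -, ha, -⟩ := exists_common_eigenvector (Commute.refl (m x)) hWbot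
      (fun w hw => h.map_mem_right hw) (fun w hw => h.map_mem_right hw)
    have ha0 : a ≠ 0 := h.eigenvalue_ne_zero he he0 ha
    obtain ⟨f, hf, hfe, hspanW⟩ := exists_pair_of_finrank_two hW he he0
    have hS := hspans hspanH hspanW
    obtain ⟨r, b, hxf⟩ := hspanW _ (h.map_mem_right hf)
    obtain ⟨γ, δ, p, q, hye⟩ := hS (m y e)
    obtain ⟨γ', δ', p', q', hyf⟩ := hS (m y f)
    have e₁ := hcomm e
    have e₂ := hcomm f
    rw [ha, map_smul, hye] at e₁
    rw [hxf, map_add, map_smul, map_smul, hye, hyf] at e₂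
    simp only [map_add, map_smul, hxx, hα, ha, hxf, smul_zero] at e₁ e₂
    have E₁ : (δ * α - a * γ) • x + (-(a * δ)) • y + (q * r - α * a) • e + (q * b - a * q) • f = 0 := by
      linear_combination (norm := module) e₁
    have E₂ : (δ' * α - b * γ' - r * γ) • x + (-(b * δ') - r * δ) • y +
        (p' * a + q' * r - b * p' - r * p - α * r) • e + (-(r * q) - α * b) • f = 0 := by
      linear_combination (norm := module) e₂
    obtain ⟨-, -, h₁, h₂⟩ := hS.coeff_eq_zero E₁
    obtain ⟨-, -, -, h₃⟩ := hS.coeff_eq_zero E₂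
    have hq : q ≠ 0 := by
      rintro rfl
      exact mul_ne_zero hα0 ha0 (by linear_combination -h₁)
    have hab : b = a := mul_left_cancel₀ hq (by linear_combination h₂)
    have : α * a = 0 := by
      rw [hab] at h₃
      linear_combination -(h₁ + h₃) / 2
    exact mul_ne_zero hα0 ha0 this
  have hcomm : ∀ v, m x (m y v) = m y (m x v) := fun v => by
    rw [LieStr.mul_mul hm x y v, hxy, map_zero, LinearMap.zero_apply, zero_add]
  have hXY : Commute (m x : Module.End ℂ (Fin 4 → ℂ)) (m y) := LinearMap.ext hcomm
  obtain ⟨e, he, he0, a, a', ha, ha'⟩ := exists_common_eigenvector hXY hWbot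
    (fun w hw => h.map_mem_right hw) (fun w hw => h.comm _ hXY.symm w hw)
  have ha0 : a ≠ 0 := h.eigenvalue_ne_zero he he0 ha
  obtain ⟨f, hf, hfe, hspanW⟩ := exists_pair_of_finrank_two hW he he0
  obtain ⟨y₁, hy₁⟩ : ∃ y₁, y₁ = y - (a' / a) • x := ⟨_, rfl⟩
  have hspanH₁ : ∀ v ∈ H, ∃ s t : ℂ, v = s • x + t • y₁ := by
    intro v hv
    obtain ⟨s, t, rfl⟩ := hspanH v hv
    exact ⟨s + t * (a' / a), t, by rw [hy₁]; module⟩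
  have hxy₁ : m x y₁ = 0 := by rw [hy₁, map_sub, map_smul, hxy, hxx, smul_zero, sub_zero]
  have hy₁x : m y₁ x = 0 := by rw [LieStr.neg_swap hm, hxy₁, neg_zero]
  have hye : m y₁ e = 0 := by
    rw [hy₁, map_sub, map_smul, LinearMap.sub_apply, LinearMap.smul_apply, ha, ha', smul_smul,
      div_mul_cancel₀ _ ha0, sub_self]
  have hcomm₁ : ∀ v, m x (m y₁ v) = m y₁ (m x v) := fun v => by
    rw [LieStr.mul_mul hm x y₁ v, hxy₁, map_zero, LinearMap.zero_apply, zero_add]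
  have hS := hspans hspanH₁ hspanW
  obtain ⟨r, b, hxf⟩ := hspanW _ (h.map_mem_right hf)
  obtain ⟨r', b', hyf⟩ := hspanW _ (h.comm (m y₁) (LinearMap.ext fun v => (hcomm₁ v).symm) f hf)
  have hb0 : b ≠ 0 := by
    rintro rfl
    have : f - (r / a) • e = 0 := by
      refine h.eq_zero_of_mem ((h.mem_iff _).2 ⟨1, ?_⟩) (sub_mem hf (W.smul_mem _ he))
      rw [pow_one, map_sub, map_smul, hxf, ha, smul_smul, div_mul_cancel₀ _ ha0]
      module
    exact hfe _ (sub_eq_zero.1 this)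
  have hrel : b' * r + r' * a = b * r' := by
    have e₁ := hcomm₁ f
    rw [hyf, hxf] at e₁
    simp only [map_add, map_smul, ha, hye, hxf, hyf, smul_zero] at e₁
    have E₁ : (0 : ℂ) • x + (0 : ℂ) • y₁ + (b' * r + r' * a - b * r') • e + (0 : ℂ) • f = 0 := by
      linear_combination (norm := module) e₁
    exact sub_eq_zero.1 (hS.coeff_eq_zero E₁).2.2.1
  have hxz : m x (m e f) = (a + b) • m e f := by
    rw [LieStr.mul_mul hm, ha, hxf]
    simp only [map_add, map_smul, LinearMap.smul_apply, hm.1]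
    module
  have hyz : m y₁ (m e f) = b' • m e f := by
    rw [LieStr.mul_mul hm, hye, hyf]
    simp only [map_add, map_smul, map_zero, LinearMap.zero_apply, hm.1]
    module
  -- `ef` has weight `a + b` for `x`, while the eigenvalues on `W` are `a` and `b`, both nonzero. So
  -- `ef` has no component in `W`, and it vanishes unless `a + b = 0`.
  obtain ⟨α, β, γ, δ, hz⟩ := hS (m e f)
  have hxz' : (α * (a + b)) • x + (β * (a + b)) • y₁ + (γ * b - δ * r) • e + (δ * a) • f = 0 := by
    rw [hz] at hxz
    simp only [map_add, map_smul, hxx, hxy₁, ha, hxf, smul_zero] at hxz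
    linear_combination (norm := module) -hxz
  obtain ⟨hα, hβ, hγ, hδ⟩ := hS.coeff_eq_zero hxz'
  have hδ0 : δ = 0 := (mul_eq_zero.1 hδ).resolve_right ha0
  have hγ0 : γ = 0 := by
    rw [hδ0, zero_mul, sub_zero] at hγ
    exact (mul_eq_zero.1 hγ).resolve_right hb0
  rw [hγ0, hδ0, zero_smul, zero_smul, add_zero, add_zero] at hz
  by_cases hb' : b' = 0
  swap
  · have hz0 : m e f = 0 := by
      have : m y₁ (m e f) = 0 := by
        rw [hz, map_add, map_smul, map_smul, hy₁x, hm.1]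
        simp
      rw [hyz] at this
      exact (smul_eq_zero.1 this).resolve_left hb'
    -- `y₁` has the distinct eigenvalues `0` and `b'` on `W`, with eigenvectors `e` and `f + (r' /
    -- b') • e`. By `hrel` the vector `x - (b / b') • y₁` kills the second one.
    refine Or.inl (Or.inl (Or.inr (subset_closure ?_)))
    refine mem_orbit_anticomm hm (u₀ := a⁻¹ • (x - (b / b') • y₁)) (u₁ := e) (u₂ := b'⁻¹ • y₁)
      (u₃ := f + (r' / b') • e) ?_ ?_ ?_ ?_ ?_ ?_ ?_
    · refine hS.trans ⟨a, 0, b, 0, ?_⟩ ⟨0, 0, b', 0, ?_⟩ ⟨0, 1, 0, 0, by module⟩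
        ⟨0, -(r' / b'), 0, 1, by module⟩ <;> match_scalars <;> field_simp <;> ring
    · simp [ha, hye, ha0]
    · simp [hxy₁, hm.1]
    · simp only [map_smul, map_sub, map_add, LinearMap.smul_apply, LinearMap.sub_apply, hxf, hyf,
        ha, hye, Pi.zero_apply, smul_zero, zero_smul, add_zero]
      match_scalars
      · field_simp
        linear_combination hrel
      · field_simp
        ring
    · simp [LieStr.neg_swap hm e y₁, hye]
    · simp [hz0, hm.1]
    · simp [hyf, hye]
      match_scalars <;> field_simp
  subst hb'
  rw [zero_mul, zero_add] at hrel
  rw [zero_smul, add_zero] at hyf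
  by_cases hr' : r' = 0
  swap
  · have hab : a = b := mul_left_cancel₀ hr' (by linear_combination hrel)
    have hz0 : m e f = 0 := by
      rw [← hab] at hα hβ
      have h2a : a + a ≠ 0 := by
        rw [← two_mul]
        exact mul_ne_zero two_ne_zero ha0
      rw [hz, (mul_eq_zero.1 hα).resolve_right h2a, (mul_eq_zero.1 hβ).resolve_right h2a]
      simp
    refine Or.inl (Or.inr (mem_closure_g5 hm (x := x) (p := y₁) (q := f) ?_ ?_ ?_
      ⟨0, 0, 0, by rw [hxy₁]; module⟩ ⟨0, b, r / r', ?_⟩))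
    · rw [hyf]
      refine hS.trans ⟨1, 0, 0, 0, by module⟩ ⟨0, 1, 0, 0, by module⟩ ⟨0, 0, 0, r'⁻¹, ?_⟩
        ⟨0, 0, 1, 0, by module⟩
      match_scalars <;> field_simp
    · rw [hyf, map_smul, hye, smul_zero]
    · rw [hyf, map_smul, LieStr.neg_swap hm, hz0]
      simp
    · rw [hyf, hxf]
      match_scalars <;> field_simp
  subst hr'
  rw [zero_smul] at hyf
  have hey : m e y₁ = 0 := by rw [LieStr.neg_swap hm, hye, neg_zero]
  have hfy : m f y₁ = 0 := by rw [LieStr.neg_swap hm, hyf, neg_zero]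
  by_cases hz0 : m e f = 0
  · refine Or.inr (mem_closure_g4 hm (x := x) (u₁ := e) (u₂ := f) (u₃ := y₁)
      (hS.trans ⟨1, 0, 0, 0, by module⟩ ⟨0, 0, 0, 1, by module⟩ ⟨0, 1, 0, 0, by module⟩
        ⟨0, 0, 1, 0, by module⟩) hz0 hey hfy ⟨a, 0, 0, ?_⟩ ⟨r, b, 0, ?_⟩ ⟨0, 0, 0, ?_⟩)
    · rw [ha]; module
    · rw [hxf]; module
    · rw [hxy₁]; module
  have hab : a + b = 0 := by
    by_contra hne
    exact hz0 (by rw [hz, (mul_eq_zero.1 hα).resolve_right hne,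
      (mul_eq_zero.1 hβ).resolve_right hne]; simp)
  obtain rfl : b = -a := by linear_combination hab
  by_cases hα0 : α = 0
  · rw [hα0, zero_smul, zero_add] at hz
    have hβ0 : β ≠ 0 := by
      rintro rfl
      exact hz0 (by rw [hz, zero_smul])
    refine Or.inl (Or.inr (mem_closure_g5 hm (x := x) (p := e) (q := f) ?_ ?_ ?_
      ⟨a, 0, 0, by rw [ha]; module⟩ ⟨r, -a, 0, by rw [hxf]; module⟩))
    · rw [hz]
      refine hS.trans ⟨1, 0, 0, 0, by module⟩ ⟨0, 0, 0, β⁻¹, ?_⟩ ⟨0, 1, 0, 0, by module⟩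
        ⟨0, 0, 1, 0, by module⟩
      match_scalars <;> field_simp
    · rw [hz, map_smul, hey, smul_zero]
    · rw [hz, map_smul, hfy, smul_zero]
  · refine Or.inl (Or.inl (Or.inl (subset_closure ?_)))
    have hex : m e x = -(a • e) := by rw [LieStr.neg_swap hm, ha]
    -- `u₀` is `ef / (αa)`, and `f - (r / (2a)) • e` is the eigenvector of `x` for `-a`; the scalars
    -- give the brackets of `sl2`, with `y₁` central.
    refine mem_orbit_anticomm hm (u₀ := a⁻¹ • x + (β / (α * a)) • y₁) (u₁ := e)
      (u₂ := (α * a)⁻¹ • (f - (r / (2 * a)) • e)) (u₃ := y₁) ?_ ?_ ?_ ?_ ?_ ?_ ?_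
    · refine hS.trans ⟨a, 0, 0, -(β / α), ?_⟩ ⟨0, 0, 0, 1, by module⟩ ⟨0, 1, 0, 0, by module⟩
        ⟨0, r / (2 * a), α * a, 0, ?_⟩ <;> match_scalars <;> field_simp <;> ring
    · simp [ha, hye, ha0]
    · simp [ha, hye, hxf, hyf]
      match_scalars <;> field_simp
      ring
    · simp [hxy₁, hm.1]
    · simp [hz, hm.1]
      match_scalars <;> field_simp
    · simp [hey]
    · simp [hey, hfy]

/-- Now `W` is an ideal of codimension one on which `x` is triangular with nonzero eigenvalues `a,
b, c`. Products in `W` have as weights sums of two eigenvalues, so a nonzero product forces one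
eigenvalue to be the sum of the other two and produces a Heisenberg ideal. Otherwise `W` is abelian.
-/
theorem mem_fourFamilies_of_finrank_three {m : AlgStr 4} (hm : m ∈ LieStr 4) {x : Fin 4 → ℂ}
    {H W : Submodule ℂ (Fin 4 → ℂ)} (h : IsFitting (m x) H W) (hW : Module.finrank ℂ W = 3) :
    m ∈ fourFamilies := by
  have hsum := Submodule.finrank_add_eq_of_isCompl h.compl
  rw [hW, Module.finrank_fin_fun] at hsum
  have hxx := hm.1 x
  have hxH : x ∈ H := (h.mem_iff x).2 ⟨1, by simpa using hxx⟩
  have hx0 : x ≠ 0 := by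
    rintro rfl
    have : W = ⊥ := by
      refine (Submodule.eq_bot_iff _).2 fun w hw => ?_
      obtain ⟨w', -, rfl⟩ := h.surj w hw
      simp
    subst this
    simp at hW
  have hH : Module.finrank ℂ H = 1 := by omega
  have hspanH : ∀ v ∈ H, ∃ s : ℂ, v = s • x := by
    intro v hv
    obtain ⟨c, hc⟩ := (finrank_eq_one_iff_of_nonzero' (⟨x, hxH⟩ : H)
      (fun h0 => hx0 (congrArg Subtype.val h0))).1 hH ⟨v, hv⟩
    exact ⟨c, (congrArg Subtype.val hc).symm⟩
  obtain ⟨⟨e, he⟩, ⟨f, hf⟩, ⟨g, hg⟩, a, b, c, r, q, p, hli, ha, hb, hc⟩ :=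
    exists_flag hW ((m x : Module.End ℂ _).restrict fun w hw => h.map_mem_right hw)
  have ha : m x e = a • e := congrArg Subtype.val ha
  have hb : m x f = b • f + r • e := congrArg Subtype.val hb
  have hc : m x g = c • g + q • f + p • e := congrArg Subtype.val hc
  have hspanW : ∀ w ∈ W, ∃ s t u : ℂ, w = s • e + t • f + u • g := by
    intro w hw
    let B := basisOfLinearIndependentOfCardEqFinrank hli (by simp [hW])
    have := B.sum_repr ⟨w, hw⟩
    simp only [B, Fin.sum_univ_three, coe_basisOfLinearIndependentOfCardEqFinrank,
      Matrix.cons_val] at this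
    exact ⟨_, _, _, (congrArg Subtype.val this).symm⟩
  have hS : Spans x e f g := by
    intro v
    obtain ⟨u, hu, w, hw, rfl⟩ := h.exists_add v
    obtain ⟨s, rfl⟩ := hspanH u hu
    obtain ⟨s', t', u', rfl⟩ := hspanW w hw
    exact ⟨s, s', t', u', by module⟩
  -- the eigenvalues are nonzero
  have hker : ∀ w ∈ W, m x w = 0 → w = 0 := fun w hw h0 =>
    h.eq_zero_of_mem ((h.mem_iff w).2 ⟨1, by simpa using h0⟩) hw
  have ha0 : a ≠ 0 := by
    rintro rfl
    have h0 := hker e he (by rw [ha, zero_smul])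
    have := hS.coeff_eq_zero (a := 0) (b := 1) (c := 0) (d := 0) (by rw [h0]; simp)
    simp at this
  have hb0 : b ≠ 0 := by
    rintro rfl
    have h0 := hker (f - (r / a) • e) (sub_mem hf (W.smul_mem _ he)) (by
      rw [map_sub, map_smul, ha, hb, smul_smul, div_mul_cancel₀ _ ha0]
      module)
    have := hS.coeff_eq_zero (a := 0) (b := -(r / a)) (c := 1) (d := 0) (by
      linear_combination (norm := module) h0)
    simp at this
  have hc0 : c ≠ 0 := by
    rintro rfl
    have h0 := hker (g - (q / b) • f - ((p - q / b * r) / a) • e)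
      (sub_mem (sub_mem hg (W.smul_mem _ hf)) (W.smul_mem _ he)) (by
      rw [map_sub, map_sub, map_smul, map_smul, ha, hb, hc]
      match_scalars <;> field_simp <;> ring)
    have := hS.coeff_eq_zero (a := 0) (b := -((p - q / b * r) / a)) (c := -(q / b)) (d := 1) (by
      linear_combination (norm := module) h0)
    simp at this
  -- products of elements of `W`
  have hz₁ : m x (m e f) = (a + b) • m e f := by
    rw [LieStr.mul_mul hm, ha, hb]
    simp only [map_add, map_smul, LinearMap.smul_apply, hm.1]
    module
  have hz₂ : m x (m e g) = (a + c) • m e g + q • m e f := by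
    rw [LieStr.mul_mul hm, ha, hc]
    simp only [map_add, map_smul, LinearMap.smul_apply, hm.1]
    module
  have hz₃ : m x (m f g) = (b + c) • m f g - p • m e f + r • m e g := by
    rw [LieStr.mul_mul hm, hb, hc]
    simp only [map_add, map_smul, LinearMap.smul_apply, LinearMap.add_apply, hm.1,
      LieStr.neg_swap hm f e]
    module
  have htr : LinearMap.trace ℂ _ (m x : Module.End ℂ (Fin 4 → ℂ)) = a + b + c := by
    obtain ⟨B, hB⟩ := hS.exists_basis
    rw [LinearMap.trace_eq_matrix_trace ℂ B, Matrix.trace]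
    have B0 : B 0 = x := by rw [hB]; rfl
    have B1 : B 1 = e := by rw [hB]; rfl
    have B2 : B 2 = f := by rw [hB]; rfl
    have B3 : B 3 = g := by rw [hB]; rfl
    simp only [Fin.sum_univ_four, Matrix.diag_apply, LinearMap.toMatrix_apply, B0, B1, B2, B3, hxx,
      ha, hb, hc]
    simp only [← B1, ← B2, ← B3]
    simp
  have htrace : ∀ u v, LinearMap.trace ℂ _ (m (m u v) : Module.End ℂ (Fin 4 → ℂ)) = 0 := by
    intro u v
    have : (m (m u v) : Module.End ℂ (Fin 4 → ℂ)) =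
        (m u : Module.End ℂ _) * m v - (m v : Module.End ℂ _) * m u := by
      refine LinearMap.ext fun z => ?_
      simp only [LinearMap.sub_apply, Module.End.mul_apply]
      rw [LieStr.mul_mul hm u v z]
      abel
    rw [this, map_sub, LinearMap.trace_mul_comm, sub_self]
  -- The trace of the left multiplication vanishes on products. Elements of `W` are products, since
  -- `m x` maps `W` onto itself, so the `x`-component of `uv` is the only one that could contribute
  -- to the trace.
  have hWtr : ∀ u v, a + b + c ≠ 0 → m u v ∈ W := by
    intro u v hne
    obtain ⟨y, hy, w, hw, huv⟩ := h.exists_add (m u v)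
    obtain ⟨s, rfl⟩ := hspanH y hy
    obtain ⟨w', -, rfl⟩ := h.surj w hw
    have := htrace u v
    rw [huv, map_add, map_add, htrace, map_smul, map_smul, htr, add_zero, smul_eq_mul] at this
    rw [huv, (mul_eq_zero.1 this).resolve_right hne, zero_smul, zero_add]
    exact hw
  -- If the trace is zero, then `a + b = -c ≠ 0`, and an eigenvector of nonzero weight lies in `W`.
  -- The next two products are handled alike, modulo the earlier ones.
  have hW₁ : m e f ∈ W := by
    by_cases hne : a + b + c = 0
    · refine h.mem_right_of_eigen (c := a + b) (fun h0 => hc0 (by linear_combination hne - h0)) ?_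
      rw [hz₁, sub_self]
      exact W.zero_mem
    · exact hWtr _ _ hne
  have hW₂ : m e g ∈ W := by
    by_cases hne : a + b + c = 0
    · refine h.mem_right_of_eigen (c := a + c) (fun h0 => hb0 (by linear_combination hne - h0)) ?_
      rw [hz₂, add_sub_cancel_left]
      exact W.smul_mem _ hW₁
    · exact hWtr _ _ hne
  have hW₃ : m f g ∈ W := by
    by_cases hne : a + b + c = 0
    · refine h.mem_right_of_eigen (c := b + c) (fun h0 => ha0 (by linear_combination hne - h0)) ?_
      have : m x (m f g) - (b + c) • m f g = r • m e g - p • m e f := by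
        rw [hz₃]
        module
      rw [this]
      exact sub_mem (W.smul_mem _ hW₂) (W.smul_mem _ hW₁)
    · exact hWtr _ _ hne
  -- eigenvectors in `W`
  have hcoeff : ∀ {l s t u : ℂ}, m x (s • e + t • f + u • g) = l • (s • e + t • f + u • g) →
      s * (a - l) + t * r + u * p = 0 ∧ t * (b - l) + u * q = 0 ∧ u * (c - l) = 0 := by
    intro l s t u hl
    simp only [map_add, map_smul, ha, hb, hc] at hl
    have := hS.coeff_eq_zero (a := 0) (b := s * (a - l) + t * r + u * p)
      (c := t * (b - l) + u * q) (d := u * (c - l)) (by linear_combination (norm := module) hl)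
    exact ⟨this.2.1, this.2.2.1, this.2.2.2⟩
  have heig : ∀ {l : ℂ} {w : Fin 4 → ℂ}, w ∈ W → m x w = l • w → l ≠ a → l ≠ b → l ≠ c →
      w = 0 := by
    intro l w hw hl hla hlb hlc
    obtain ⟨s, t, u, rfl⟩ := hspanW w hw
    obtain ⟨h1, h2, h3⟩ := hcoeff hl
    obtain rfl : u = 0 := (mul_eq_zero.1 h3).resolve_right (sub_ne_zero.2 hlc.symm)
    rw [zero_mul, add_zero] at h2
    obtain rfl : t = 0 := (mul_eq_zero.1 h2).resolve_right (sub_ne_zero.2 hlb.symm)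
    rw [zero_mul, zero_mul, add_zero, add_zero] at h1
    obtain rfl : s = 0 := (mul_eq_zero.1 h1).resolve_right (sub_ne_zero.2 hla.symm)
    simp
  have hfe : m f e = -m e f := LieStr.neg_swap hm f e
  have hge : m g e = -m e g := LieStr.neg_swap hm g e
  have hgf : m g f = -m f g := LieStr.neg_swap hm g f
  by_cases h₁ : m e f = 0
  swap
  · -- `c = a + b`
    have hcab : c = a + b := by
      by_contra hne
      exact h₁ (heig hW₁ hz₁ (fun h0 => hb0 (by linear_combination h0))
        (fun h0 => ha0 (by linear_combination h0)) (fun h0 => hne h0.symm))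
    obtain ⟨s, t, u, hz⟩ := hspanW _ hW₁
    have hu : u ≠ 0 := by
      rintro rfl
      rw [hz] at hz₁
      obtain ⟨h1, h2, -⟩ := hcoeff hz₁
      have ht : t = 0 := by
        have : t * a = 0 := by linear_combination -h2
        exact (mul_eq_zero.1 this).resolve_right ha0
      have hs : s = 0 := by
        have : s * b = 0 := by rw [ht] at h1; linear_combination -h1
        exact (mul_eq_zero.1 this).resolve_right hb0
      exact h₁ (by rw [hz, ht, hs]; simp)
    -- The weight is `2a + b = a + c`; equality with `a`, `b` or `c` would make `c`, `2a` or `a`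
    -- vanish.
    have hez : m e (m e f) = 0 := by
      refine heig (l := a + c) ?_ ?_ ?_ ?_ ?_
      · rw [hz]
        simp only [map_add, map_smul, hm.1]
        exact add_mem (add_mem (W.smul_mem _ W.zero_mem) (W.smul_mem _ hW₁)) (W.smul_mem _ hW₂)
      · rw [LieStr.mul_mul hm x e, ha, hz₁, map_smul, map_smul, LinearMap.smul_apply, ← add_smul,
          hcab]
      · exact fun h0 => hc0 (by linear_combination h0)
      · exact fun h0 => ha0 (by linear_combination (h0 - hcab) / 2)
      · exact fun h0 => ha0 (by linear_combination h0)
    have hfz : m f (m e f) = 0 := by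
      refine heig (l := b + c) ?_ ?_ ?_ ?_ ?_
      · rw [hz]
        simp only [map_add, map_smul, hm.1, hfe]
        exact add_mem (add_mem (W.smul_mem _ (neg_mem hW₁)) (W.smul_mem _ W.zero_mem))
          (W.smul_mem _ hW₃)
      · rw [LieStr.mul_mul hm x f, hb, hz₁, map_smul, map_add, LinearMap.add_apply, map_smul,
          map_smul, LinearMap.smul_apply, LinearMap.smul_apply, hez, smul_zero, add_zero,
          ← add_smul, hcab]
      · exact fun h0 => hb0 (by linear_combination (h0 - hcab) / 2)
      · exact fun h0 => hc0 (by linear_combination h0)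
      · exact fun h0 => hb0 (by linear_combination h0)
    refine Or.inl (Or.inr (mem_closure_g5 hm (x := x) (p := e) (q := f) ?_ hez hfz
      ⟨a, 0, 0, by rw [ha]; module⟩ ⟨r, b, 0, by rw [hb]; module⟩))
    refine hS.trans ⟨1, 0, 0, 0, by module⟩ ⟨0, 1, 0, 0, by module⟩ ⟨0, 0, 1, 0, by module⟩
      ⟨0, -(s / u), -(t / u), u⁻¹, ?_⟩
    rw [hz]
    match_scalars <;> field_simp <;> ring
  rw [h₁, smul_zero, add_zero] at hz₂
  rw [h₁, smul_zero, sub_zero] at hz₃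
  by_cases h₂ : m e g = 0
  swap
  · -- `b = a + c`
    have hbac : b = a + c := by
      by_contra hne
      exact h₂ (heig hW₂ hz₂ (fun h0 => hc0 (by linear_combination h0))
        (fun h0 => hne h0.symm) (fun h0 => ha0 (by linear_combination h0)))
    obtain ⟨s, t, u, hz⟩ := hspanW _ hW₂
    obtain ⟨h1, h2, h3⟩ := hcoeff (hz ▸ hz₂)
    have hu : u = 0 := by
      have : u * a = 0 := by linear_combination -h3
      exact (mul_eq_zero.1 this).resolve_right ha0
    rw [hu, zero_smul, add_zero] at hz
    have ht : t ≠ 0 := by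
      rintro rfl
      have hs : s = 0 := by
        have : s * c = 0 := by rw [hu] at h1; linear_combination -h1
        exact (mul_eq_zero.1 this).resolve_right hc0
      exact h₂ (by rw [hz, hs]; simp)
    have hez : m e (m e g) = 0 := by rw [hz, map_add, map_smul, map_smul, hm.1, h₁]; simp
    have hfz : m f (m e g) = 0 := by rw [hz, map_add, map_smul, map_smul, hm.1, hfe, h₁]; simp
    have hgz : m g (m e g) = 0 := by
      refine heig (l := b + c) ?_ ?_ ?_ ?_ ?_
      · rw [hz]
        simp only [map_add, map_smul, hge, hgf]
        exact add_mem (W.smul_mem _ (neg_mem hW₂)) (W.smul_mem _ (neg_mem hW₃))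
      · rw [LieStr.mul_mul hm x g, hc, hz₂]
        simp only [map_add, map_smul, LinearMap.add_apply, LinearMap.smul_apply, hez, hfz,
          smul_zero, add_zero, ← add_smul]
        rw [hbac]
        congr 1
        ring
      · exact fun h0 => hc0 (by linear_combination (h0 - hbac) / 2)
      · exact fun h0 => hc0 (by linear_combination h0)
      · exact fun h0 => hb0 (by linear_combination h0)
    refine Or.inl (Or.inr (mem_closure_g5 hm (x := x) (p := e) (q := g) ?_ hez hgz
      ⟨a, 0, 0, by rw [ha]; module⟩ ⟨p - q * s / t, c, q / t, ?_⟩))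
    · refine hS.trans ⟨1, 0, 0, 0, by module⟩ ⟨0, 1, 0, 0, by module⟩ ⟨0, -(s / t), 0, t⁻¹, ?_⟩
        ⟨0, 0, 1, 0, by module⟩
      rw [hz]
      match_scalars <;> field_simp
      ring
    · rw [hc, hz]
      match_scalars <;> field_simp
      ring
  rw [h₂, smul_zero, add_zero] at hz₃
  by_cases h₃ : m f g = 0
  swap
  · -- `a = b + c`
    have habc : a = b + c := by
      by_contra hne
      exact h₃ (heig hW₃ hz₃ (fun h0 => hne h0.symm) (fun h0 => hc0 (by linear_combination h0))
        (fun h0 => hb0 (by linear_combination h0)))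
    obtain ⟨s, t, u, hz⟩ := hspanW _ hW₃
    obtain ⟨h1, h2, h3⟩ := hcoeff (hz ▸ hz₃)
    have hu : u = 0 := by
      have : u * b = 0 := by linear_combination -h3
      exact (mul_eq_zero.1 this).resolve_right hb0
    have ht : t = 0 := by
      have : t * c = 0 := by rw [hu] at h2; linear_combination -h2
      exact (mul_eq_zero.1 this).resolve_right hc0
    rw [hu, ht, zero_smul, zero_smul, add_zero, add_zero] at hz
    have hs : s ≠ 0 := by
      rintro rfl
      exact h₃ (by rw [hz, zero_smul])
    refine Or.inl (Or.inr (mem_closure_g5 hm (x := x) (p := f) (q := g) ?_ ?_ ?_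
      ⟨b, 0, r / s, ?_⟩ ⟨q, c, p / s, ?_⟩))
    · refine hS.trans ⟨1, 0, 0, 0, by module⟩ ⟨0, 0, 0, s⁻¹, ?_⟩ ⟨0, 1, 0, 0, by module⟩
        ⟨0, 0, 1, 0, by module⟩
      rw [hz]
      match_scalars <;> field_simp
    · rw [hz, map_smul, hfe, h₁]; simp
    · rw [hz, map_smul, hge, h₂]; simp
    · rw [hb, hz]
      match_scalars <;> field_simp
    · rw [hc, hz]
      match_scalars <;> field_simp
  · exact Or.inr (mem_closure_g4 hm hS h₁ h₂ h₃ ⟨a, 0, 0, by rw [ha]; module⟩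
      ⟨r, b, 0, by rw [hb]; module⟩ ⟨p, q, c, by rw [hc]; module⟩)

theorem LieStr_subset_fourFamilies : LieStr 4 ⊆ fourFamilies := by
  intro m hm
  by_cases hnil : ∀ x, IsNilpotent (m x : Module.End ℂ (Fin 4 → ℂ))
  · exact mem_fourFamilies_of_isNilpotent hm hnil
  obtain ⟨x, hx⟩ := not_forall.1 hnil
  obtain ⟨H, W, h₁, h₂, h₃, h₄⟩ := exists_fitting (m x)
  have h : IsFitting (m x) H W := ⟨h₁, h₂, h₃, h₄⟩
  have hsum := Submodule.finrank_add_eq_of_isCompl h₁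
  rw [Module.finrank_fin_fun] at hsum
  have hxH : x ∈ H := (h₂ x).2 ⟨1, by simpa using hm.1 x⟩
  have hH : Module.finrank ℂ H ≠ 0 := by
    intro h0
    rw [Submodule.finrank_eq_zero] at h0
    subst h0
    obtain rfl : x = 0 := by simpa using hxH
    exact hx (by rw [map_zero]; exact IsNilpotent.zero)
  have hW : Module.finrank ℂ W ≠ 0 := by
    intro h0
    rw [Submodule.finrank_eq_zero] at h0
    have htop : H = ⊤ := by
      have := h₁.sup_eq_top
      rwa [h0, sup_bot_eq] at this
    refine hx ((Module.End.isNilpotent_iff_of_finite).2 fun v => (h₂ v).1 ?_)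
    rw [htop]
    trivial
  have : Module.finrank ℂ W = 1 ∨ Module.finrank ℂ W = 2 ∨ Module.finrank ℂ W = 3 := by omega
  rcases this with h' | h' | h'
  · exact mem_fourFamilies_of_finrank_one hm h h'
  · exact mem_fourFamilies_of_finrank_two hm h h'
  · exact mem_fourFamilies_of_finrank_three hm h h'

/-! ### Irreducible components of the two varieties -/

theorem isIrreducible_iUnion_g5 : IsIrreducible (⋃ a : ℂ, orbit (g5 a)) := by
  refine isIrreducible_of_orbit_curves ⟨g5 0, Set.mem_iUnion.2 ⟨0, mem_orbit_self _⟩⟩ ?_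
  intro m₀ h₀ m₁ h₁
  obtain ⟨a₀, h₀⟩ := Set.mem_iUnion.1 h₀
  obtain ⟨a₁, h₁⟩ := Set.mem_iUnion.1 h₁
  have hG : (fun s => a₀ + s * (a₁ - a₀)) ∈ polyFun :=
    add_mem (const_mem polyFun a₀) (mul_mem id_mem_polyFun (const_mem polyFun _))
  refine ⟨fun s => g5 (a₀ + s * (a₁ - a₀)), ?_, by simpa using h₀, by simpa using h₁,
    fun t => Set.subset_iUnion (fun a => orbit (g5 a)) _⟩
  have hG' : (fun s => a₀ + s * (a₁ - a₀) + 1) ∈ polyFun := add_mem hG (const_mem polyFun 1)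
  refine polyCurve_anticomm ?_ ?_ ?_ ?_ ?_ ?_ <;> intro k <;> fin_cases k <;>
    first | exact hG | exact hG' | exact const_mem _ _

theorem isIrreducible_iUnion_g4 : IsIrreducible (⋃ a : ℂ, ⋃ b : ℂ, orbit (g4 a b)) := by
  have hmem : ∀ {m}, m ∈ (⋃ a : ℂ, ⋃ b : ℂ, orbit (g4 a b)) ↔ ∃ a b, m ∈ orbit (g4 a b) := by
    simp
  refine isIrreducible_of_orbit_curves ⟨g4 0 0, hmem.2 ⟨0, 0, mem_orbit_self _⟩⟩ ?_
  intro m₀ h₀ m₁ h₁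
  obtain ⟨a₀, b₀, h₀⟩ := hmem.1 h₀
  obtain ⟨a₁, b₁, h₁⟩ := hmem.1 h₁
  have hG : ∀ a₀ a₁ : ℂ, (fun s => a₀ + s * (a₁ - a₀)) ∈ polyFun := fun a₀ a₁ =>
    add_mem (const_mem polyFun a₀) (mul_mem id_mem_polyFun (const_mem polyFun _))
  refine ⟨fun s => g4 (a₀ + s * (a₁ - a₀)) (b₀ + s * (b₁ - b₀)), ?_, by simpa using h₀,
    by simpa using h₁, fun t m hm => hmem.2 ⟨_, _, hm⟩⟩
  refine polyCurve_anticomm ?_ ?_ ?_ ?_ ?_ ?_ <;> intro k <;> fin_cases k <;>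
    first | exact hG _ _ | exact const_mem _ _

theorem closure_iUnion_g5_subset {Z : Set (AlgStr 4)} (hZ : IsClosed Z)
    (h : ∀ a, orbit (g5 a) ⊆ Z) : closure (⋃ a : ℂ, orbit (g5 a)) ⊆ Z :=
  closure_minimal (Set.iUnion_subset h) hZ

theorem closure_iUnion_g4_subset {Z : Set (AlgStr 4)} (hZ : IsClosed Z)
    (h : ∀ a b, orbit (g4 a b) ⊆ Z) : closure (⋃ a : ℂ, ⋃ b : ℂ, orbit (g4 a b)) ⊆ Z :=
  closure_minimal (Set.iUnion_subset fun a => Set.iUnion_subset (h a)) hZ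

theorem sl2_mem_closure : sl2 ∈ closure (orbit sl2) := subset_closure (mem_orbit_self _)

theorem R2_mem_closure : R2 ∈ closure (orbit R2) := subset_closure (mem_orbit_self _)

theorem g5_mem_closure (a : ℂ) : g5 a ∈ closure (⋃ a : ℂ, orbit (g5 a)) :=
  subset_closure (Set.mem_iUnion.2 ⟨a, mem_orbit_self _⟩)

theorem g4_mem_closure (a b : ℂ) : g4 a b ∈ closure (⋃ a : ℂ, ⋃ b : ℂ, orbit (g4 a b)) :=
  subset_closure (Set.mem_iUnion.2 ⟨a, Set.mem_iUnion.2 ⟨b, mem_orbit_self _⟩⟩)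

/-- If a set is the union of finitely many closed irreducible sets, none of which contains another,
then these are its components. -/
theorem componentsOf_eq_range {n : ℕ} {ι : Type*} [Finite ι] {X : Set (AlgStr n)}
    {Z : ι → Set (AlgStr n)} (hc : ∀ i, IsClosed (Z i)) (hirr : ∀ i, IsIrreducible (Z i))
    (hX : X = ⋃ i, Z i) (hne : ∀ i j, Z i ⊆ Z j → i = j) : componentsOf X = Set.range Z := by
  have hsub : ∀ D ⊆ X, IsIrreducible D → ∃ i, D ⊆ Z i := by
    intro D hD hirrD
    obtain ⟨s, hs, hDs⟩ := isIrreducible_iff_sUnion_isClosed.1 hirrD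
      (Set.finite_range Z).toFinset (by simpa using hc) (by simpa [hX] using hD)
    obtain ⟨i, rfl⟩ : ∃ i, Z i = s := by simpa using hs
    exact ⟨i, hDs⟩
  have hZX : ∀ i, Z i ⊆ X := fun i => hX ▸ Set.subset_iUnion Z i
  ext C
  rw [mem_componentsOf]
  constructor
  · rintro ⟨hCX, hC, hmax⟩
    obtain ⟨i, hi⟩ := hsub C hCX hC
    exact ⟨i, (hmax _ (hZX i) (hirr i) hi).antisymm hi⟩
  · rintro ⟨i, rfl⟩
    refine ⟨hZX i, hirr i, fun D hD hirrD hZD => ?_⟩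
    obtain ⟨j, hj⟩ := hsub D hD hirrD
    obtain rfl := hne i j (hZD.trans hj)
    exact hj

/-- A component of the variety of Lie algebras, some point of which has a neighbourhood in the
variety of Leibniz algebras consisting of Lie algebras, is a component of the latter. -/
theorem mem_componentsOf_Leib {n : ℕ} {C : Set (AlgStr n)} (hC : C ∈ componentsOf (LieStr n))
    {F : AlgStr n → ℂ} (hF : F ∈ regFun n) (hlie : ∀ m ∈ Leib n, F m ≠ 0 → m ∈ LieStr n)
    {m : AlgStr n} (hm : m ∈ C) (hFm : F m ≠ 0) : C ∈ componentsOf (Leib n) := by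
  rw [mem_componentsOf] at hC ⊢
  obtain ⟨hCX, hirr, hmax⟩ := hC
  refine ⟨hCX.trans (LieStr_subset_Leib n), hirr, fun D hD hirrD hCD => ?_⟩
  refine hmax D ?_ hirrD hCD
  -- `D` is covered by the closed sets `F = 0` and `LieStr n`. It is not inside the first because of
  -- `m`, so it consists of Lie algebras.
  rcases isPreirreducible_iff_isClosed_union_isClosed.1 hirrD.2 {m | F m = 0} (LieStr n)
    (isClosed_of_regFun hF) (isClosed_LieStr n) (fun m' hm' => by
      by_cases h0 : F m' = 0
      · exact Or.inl h0
      · exact Or.inr (hlie m' (hD hm') h0)) with h | h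
  · exact absurd (h (hCD hm)) hFm
  · exact h

/-- The four closed sets. -/
def lieComponent : Fin 4 → Set (AlgStr 4) :=
  ![closure (orbit sl2), closure (orbit R2), closure (⋃ a : ℂ, orbit (g5 a)),
    closure (⋃ a : ℂ, ⋃ b : ℂ, orbit (g4 a b))]

/-- `sl2` alone violates Cartan's criterion and is unimodular. `R2` is excluded from the two
families by its independent traces, and `g5 1` from `R2` and `g4` because it is not metabelian. `g4
1 1` is excluded by its eigenvalues `1, 1, 1`: their product is not zero, and none is the sum of the
other two. -/
theorem eq_of_lieComponent_subset (i j : Fin 4) (h : lieComponent i ⊆ lieComponent j) : i = j := by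
  have u := closure_minimal (orbit_subset_unimodular sl2_mem_unimodular) (isClosed_unimodular 4)
  have t₁ := closure_minimal (orbit_subset_traceSolvable R2_mem_traceSolvable)
    (isClosed_traceSolvable 4)
  have t₂ := closure_iUnion_g5_subset (isClosed_traceSolvable 4)
    fun a => orbit_subset_traceSolvable (g5_mem_traceSolvable a)
  have t₃ := closure_iUnion_g4_subset (isClosed_traceSolvable 4)
    fun a b => orbit_subset_traceSolvable (g4_mem_traceSolvable a b)
  have p₂ := closure_iUnion_g5_subset (isClosed_traceProportional 4)
    fun a => orbit_subset_traceProportional (g5_mem_traceProportional a)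
  have p₃ := closure_iUnion_g4_subset (isClosed_traceProportional 4)
    fun a b => orbit_subset_traceProportional (g4_mem_traceProportional a b)
  have m₁ := closure_minimal (orbit_subset_metabelian R2_mem_metabelian) (isClosed_metabelian 4)
  have m₃ := closure_iUnion_g4_subset (isClosed_metabelian 4)
    fun a b => orbit_subset_metabelian (g4_mem_metabelian a b)
  have s₁ := closure_minimal (orbit_subset_thirdSymmZero R2_mem_thirdSymmZero)
    (isClosed_thirdSymmZero 4)
  have e₂ := closure_iUnion_g5_subset (isClosed_eigenvalueSum 4)
    fun a => orbit_subset_eigenvalueSum (g5_mem_eigenvalueSum a)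
  fin_cases i <;> fin_cases j
  · rfl
  · exact absurd (t₁ (h sl2_mem_closure)) sl2_notMem_traceSolvable
  · exact absurd (t₂ (h sl2_mem_closure)) sl2_notMem_traceSolvable
  · exact absurd (t₃ (h sl2_mem_closure)) sl2_notMem_traceSolvable
  · exact absurd (u (h R2_mem_closure)) R2_notMem_unimodular
  · rfl
  · exact absurd (p₂ (h R2_mem_closure)) R2_notMem_traceProportional
  · exact absurd (p₃ (h R2_mem_closure)) R2_notMem_traceProportional
  · exact absurd (u (h (g5_mem_closure 1))) g5_notMem_unimodular
  · exact absurd (m₁ (h (g5_mem_closure 1))) g5_notMem_metabelian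
  · rfl
  · exact absurd (m₃ (h (g5_mem_closure 1))) g5_notMem_metabelian
  · exact absurd (u (h (g4_mem_closure 1 1))) g4_notMem_unimodular
  · exact absurd (s₁ (h (g4_mem_closure 1 1))) g4_notMem_thirdSymmZero
  · exact absurd (e₂ (h (g4_mem_closure 1 1))) g4_notMem_eigenvalueSum
  · rfl

theorem lieComponent_injective : Function.Injective lieComponent := fun i j h =>
  eq_of_lieComponent_subset i j h.subset

theorem LieStr_eq_iUnion_lieComponent : LieStr 4 = ⋃ i, lieComponent i := by
  refine subset_antisymm (fun m hm => ?_) (Set.iUnion_subset fun i => ?_)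
  · rcases LieStr_subset_fourFamilies hm with ((h | h) | h) | h
    · exact Set.mem_iUnion.2 ⟨0, h⟩
    · exact Set.mem_iUnion.2 ⟨1, h⟩
    · exact Set.mem_iUnion.2 ⟨2, h⟩
    · exact Set.mem_iUnion.2 ⟨3, h⟩
  · fin_cases i
    · exact closure_minimal (orbit_subset_LieStr sl2_mem_LieStr) (isClosed_LieStr 4)
    · exact closure_minimal (orbit_subset_LieStr R2_mem_LieStr) (isClosed_LieStr 4)
    · exact closure_iUnion_g5_subset (isClosed_LieStr 4)
        fun a => orbit_subset_LieStr (g5_mem_LieStr a)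
    · exact closure_iUnion_g4_subset (isClosed_LieStr 4)
        fun a b => orbit_subset_LieStr (g4_mem_LieStr a b)

theorem componentsOf_LieStr : componentsOf (LieStr 4) = Set.range lieComponent := by
  refine componentsOf_eq_range (fun i => ?_) (fun i => ?_) LieStr_eq_iUnion_lieComponent
    eq_of_lieComponent_subset
  · fin_cases i <;> exact isClosed_closure
  · fin_cases i <;> refine isIrreducible_iff_closure.2 ?_
    · exact isIrreducible_orbit _
    · exact isIrreducible_orbit _
    · exact isIrreducible_iUnion_g5
    · exact isIrreducible_iUnion_g4

theorem traceForm_mem (x y z : Fin 4 → ℂ) :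
    (fun m : AlgStr 4 => traceForm m x (m y z)) ∈ regFun 4 :=
  trace_mem fun v => apply_mem_regFun (apply_mem_regFun (const_vec_mem v)
    (apply_mem_regFun (const_vec_mem y) (const_vec_mem z))) (const_vec_mem x)

end LeibnizVariety

theorem mainTheorem5 :
    -- the irreducible components of the variety of four dimensional Lie algebras are
    (LeibnizVariety.componentsOf (LeibnizVariety.LieStr 4) =
      {closure (LeibnizVariety.orbit LeibnizVariety.sl2),
        closure (LeibnizVariety.orbit LeibnizVariety.R2),
        closure (⋃ a : ℂ, LeibnizVariety.orbit (LeibnizVariety.g5 a)),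
        closure (⋃ a : ℂ, ⋃ b : ℂ, LeibnizVariety.orbit (LeibnizVariety.g4 a b))} ∧
    -- there are four of them
    (LeibnizVariety.componentsOf (LeibnizVariety.LieStr 4)).ncard = 4) ∧
    -- and each of them is an irreducible component of the variety of Leibniz algebras
    closure (LeibnizVariety.orbit LeibnizVariety.sl2) ∈
      LeibnizVariety.componentsOf (LeibnizVariety.Leib 4) ∧
    closure (LeibnizVariety.orbit LeibnizVariety.R2) ∈
      LeibnizVariety.componentsOf (LeibnizVariety.Leib 4) ∧
    closure (⋃ a : ℂ, LeibnizVariety.orbit (LeibnizVariety.g5 a)) ∈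
      LeibnizVariety.componentsOf (LeibnizVariety.Leib 4) ∧
    closure (⋃ a : ℂ, ⋃ b : ℂ, LeibnizVariety.orbit (LeibnizVariety.g4 a b)) ∈
      LeibnizVariety.componentsOf (LeibnizVariety.Leib 4) := by
  open LeibnizVariety in
  have hmem : ∀ i, lieComponent i ∈ componentsOf (LieStr 4) := fun i =>
    componentsOf_LieStr ▸ Set.mem_range_self i
  have hrange : Set.range LeibnizVariety.lieComponent = _ :=
    (Matrix.range_cons _ _).trans (congrArg _ ((Matrix.range_cons _ _).trans
      (congrArg _ (Matrix.range_cons_cons_empty _ _ _))))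
  refine ⟨⟨?_, ?_⟩, ?_, ?_, ?_, ?_⟩
  · rw [LeibnizVariety.componentsOf_LieStr, hrange]
    simp only [Set.singleton_union]
  · rw [LeibnizVariety.componentsOf_LieStr, ← Set.image_univ,
      Set.ncard_image_of_injective _ LeibnizVariety.lieComponent_injective, Set.ncard_univ,
      Nat.card_eq_fintype_card, Fintype.card_fin]
  -- Since `e_2 e_3 = e_1`, this value at `sl2` is the trace of the square of the right
  -- multiplication by `e_1`, which is `2`.
  · refine LeibnizVariety.mem_componentsOf_Leib (hmem 0) (LeibnizVariety.traceForm_mem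
      ![1, 0, 0, 0] ![0, 1, 0, 0] ![0, 0, 1, 0])
      (fun m hm h => LeibnizVariety.mem_LieStr_of_traceForm_ne_zero hm h)
      LeibnizVariety.sl2_mem_closure ?_
    simp [LeibnizVariety.traceForm, LeibnizVariety.trace_eq_sum, Fin.sum_univ_four,
      LeibnizVariety.sl2_apply, LeibnizVariety.rmul]
  -- The rows record `e_2 e_1 = -e_2`, `e_1 e_2 = e_2`, `e_4 e_3 = -e_4`, `e_3 e_4 = e_4`; at `R2`
  -- the matrix is diagonal with entries `±1`.
  · refine LeibnizVariety.mem_componentsOf_Leib (hmem 1)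
      (LeibnizVariety.det_structConst_mem ![1, 0, 3, 2] ![1, 1, 3, 3])
      (fun m hm h => LeibnizVariety.mem_LieStr_of_det_ne_zero hm _ _ h)
      LeibnizVariety.R2_mem_closure ?_
    simp [Matrix.det_succ_row_zero, Fin.sum_univ_succ, LeibnizVariety.R2_apply, Fin.succAbove]
  -- The first row is the `e_2`-coordinate of `e_2 e_1`, the others are the action of `e_1` on `e_2,
  -- e_3, e_4`. The matrix is triangular, and the parameter `1` keeps its diagonal nonzero; the same
  -- minor serves for `g4 1 1`.
  · refine LeibnizVariety.mem_componentsOf_Leib (hmem 2)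
      (LeibnizVariety.det_structConst_mem ![1, 0, 0, 0] ![1, 1, 2, 3])
      (fun m hm h => LeibnizVariety.mem_LieStr_of_det_ne_zero hm _ _ h)
      (LeibnizVariety.g5_mem_closure 1) ?_
    simp [Matrix.det_succ_row_zero, Fin.sum_univ_succ, LeibnizVariety.g5_apply, Fin.succAbove]
  · refine LeibnizVariety.mem_componentsOf_Leib (hmem 3)
      (LeibnizVariety.det_structConst_mem ![1, 0, 0, 0] ![1, 1, 2, 3])
      (fun m hm h => LeibnizVariety.mem_LieStr_of_det_ne_zero hm _ _ h)
      (LeibnizVariety.g4_mem_closure 1 1) ?_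
    simp [Matrix.det_succ_row_zero, Fin.sum_univ_succ, LeibnizVariety.g4_apply, Fin.succAbove]
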